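/- Fix $0<p<\tfrac12$ and let $q=1-p$. Let $Q^d$ be the hypercube graph on $\{0,1\}^d$ (two vertices are adjacent when they differ in exactly one coordinate), and let $Q_p^d$ be the random spanning subgraph of $Q^d$ in which each edge is present independently with probability $p$. Let $m_p=\lfloor 1/\log_2(1/q)\rfloor$. A cube subgraph is a subgraph of $Q^d$ for some $d\ge 0$; its size $v(H)$ is its number of vertices. For a connected cube subgraph $H$ of $Q^d$, the support $S(H)\subseteq\{1,\dots,d\}$ is the set of $i$ such that $H$ has an edge $xy$ with $x_i=0$, $y_i=1$, and $\mathrm{span}(H)=|S(H)|$. With $s=\mathrm{span}(H)$ and $\phi$ the increasing injection from $\{1,\dots,s\}$ to $\{1,\dots,d\}$ with image $S(H)$, the canonical copy of $H$ is the subgraph of $Q^s$ whose vertices and edges are the images of those of $H$ under $x\mapsto(x_{\phi(1)},\dots,x_{\phi(s)})$ (the single vertex $Q^0$ if $H$ is a single vertex). Two connected cube subgraphs are ambient-isomorphic if they have the same canonical copy. Let $e(H)$ be the number of edges of $H$ and $e'(H)$ the number of edges of the cube $Q^d$ that are not in $H$ but have both end vertices in $H$. Let $r\ge1$ and let $H_1,\dots,H_r$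 be pairwise non-ambient-isomorphic connected cube subgraphs, each of size at most $m_p$. Let $t=\min_i v(H_i)$, let $s$ be the maximum span of an $H_i$ of size $t$, and let $$c=\sum_{i:\ v(H_i)=t,\ \mathrm{span}(H_i)=s}\ \frac{1}{2^s s!}\Big(\frac{p}{q^2}\Big)^{e(H_i)}\Big(\frac1q\Big)^{e'(H_i)} .$$ For each $i$ let $Y_i=Y_i(d)$ be the number of components of $Q_p^d$ that are ambient-isomorphic to $H_i$, let $Y=Y(d)=\sum_i Y_i$ and $\lambda=\lambda(d)=\mathbb E[Y]$. Write $(d)_s=d(d-1)\cdots(d-s+1)$. An event holds wvhp if its probability is at least $1-e^{-\gamma d}$ for some constant $\gamma>0$ and all sufficiently large $d$. Then, as $d\to\infty$: (a) $c>0$ and $\lambda=(1+O(1/d))\,c\,(d)_s(2q^t)^d$; if $t\in\{1,2,3\}$ then $s=t-1$ and the error bound $O(1/d)$ may be replaced by $O(dq^d)$. Also $\mathrm{Var}(Y)=(1+O(d^tq^{td}))\,\lambda$. (b) For each $\varepsilon>0$, $|Y-\lambda|<\varepsilon\sqrt{d\lambda}$ wvhp, and also $|Y-\lambda|<\varepsilon\lambda$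 wvhp. (c) $d_{TV}(Y,\mathrm{Po}(\lambda))=O(d^tq^{td})$, where $d_{TV}(Y,Y')=\tfrac12\sum_k|\mathbb P(Y=k)-\mathbb P(Y'=k)|$, and $Y^*=(Y-\lambda)/\sqrt{\mathrm{Var}(Y)}$ converges in distribution to a standard normal random variable. -/

import Mathlib

open Filter Topology Asymptotics MeasureTheory ProbabilityTheory

/-! ### The hypercube and its subgraphs -/

/-- The hypercube `Q^d`: vertex set `{0,1}^d`, two vertices being adjacent when they differ in
exactly one coordinate. -/
def hypercube (d : ℕ) : SimpleGraph (Fin d → Bool) where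
  Adj x y := hammingDist x y = 1
  symm := ⟨fun x y h => by rw [hammingDist_comm]; exact h⟩
  loopless := ⟨fun x h => by simp at h⟩

instance hypercube.decidableAdj (d : ℕ) : DecidableRel (hypercube d).Adj :=
  fun x y => inferInstanceAs (Decidable (hammingDist x y = 1))

/-- A cube subgraph: a subgraph of `Q^d` for some `d`. -/
abbrev CubeSubgraph : Type := Σ d : ℕ, (hypercube d).Subgraph

namespace CubeSubgraph

/-- The number `v(H)` of vertices. -/
noncomputable def size (H : CubeSubgraph) : ℕ := H.2.verts.ncard

/-- The number `e(H)` of edges. -/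
noncomputable def numEdges (H : CubeSubgraph) : ℕ := H.2.edgeSet.ncard

/-- The number `e'(H)` of edges of the ambient cube which are not in `H` but have both end vertices
in `H`. -/
noncomputable def numMissingEdges (H : CubeSubgraph) : ℕ :=
  {e ∈ (hypercube H.1).edgeSet | e ∉ H.2.edgeSet ∧ ∀ v ∈ e, v ∈ H.2.verts}.ncard

open Classical in
/-- The support `S(H)`: the set of coordinates `i` such that `H` has an edge `xy` with
`x_i = 0` and `y_i = 1`. -/
noncomputable def dirSupport (H : CubeSubgraph) : Finset (Fin H.1) :=
  {i | ∃ x y, H.2.Adj x y ∧ x i = false ∧ y i = true}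

/-- The span of `H`: the number of coordinates in its support. -/
noncomputable def span (H : CubeSubgraph) : ℕ := H.dirSupport.card

theorem card_dirSupport (H : CubeSubgraph) : H.dirSupport.card = H.span := rfl

/-- The increasing injection `φ` from `[s]` to `[d]` with image the support of `H`, where `s` is the
span of `H`. -/
noncomputable def coordEmb (H : CubeSubgraph) : Fin H.span ↪o Fin H.1 :=
  H.dirSupport.orderEmbOfFin H.card_dirSupport

/-- `(x_1, …, x_d) ↦ (x_{φ(1)}, …, x_{φ(s)})`. -/
noncomputable def restrict (H : CubeSubgraph) (x : Fin H.1 → Bool) : Fin H.span → Bool :=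
  fun j => x (H.coordEmb j)

theorem restrict_adj (H : CubeSubgraph) {x y : Fin H.1 → Bool} (h : H.2.Adj x y) :
    (hypercube H.span).Adj (H.restrict x) (H.restrict y) := by
  have hxy : hammingDist x y = 1 := H.2.adj_sub h
  unfold hammingDist at hxy
  obtain ⟨i, hi⟩ := Finset.card_eq_one.1 hxy
  have hmem : ∀ k, x k ≠ y k ↔ k = i := fun k => by
    have := congrArg (k ∈ ·) hi
    simpa using this
  have hiS : i ∈ H.dirSupport := by
    have hne : x i ≠ y i := (hmem i).2 rfl
    simp only [dirSupport, Finset.mem_filter, Finset.mem_univ, true_and]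
    cases hx : x i <;> cases hy : y i
    · simp [hx, hy] at hne
    · exact ⟨x, y, h, hx, hy⟩
    · exact ⟨y, x, h.symm, hy, hx⟩
    · simp [hx, hy] at hne
  have hr : i ∈ Set.range H.coordEmb := by
    rw [coordEmb, Finset.range_orderEmbOfFin]
    exact hiS
  obtain ⟨j, hj⟩ := hr
  change hammingDist _ _ = 1
  unfold hammingDist
  refine Finset.card_eq_one.2 ⟨j, ?_⟩
  ext k
  rw [Finset.mem_filter, Finset.mem_singleton, restrict, restrict, hmem, ← hj]
  simp only [Finset.mem_univ, true_and]
  exact H.coordEmb.injective.eq_iff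

/-- The canonical copy of `H`, a subgraph of `Q^s` where `s` is the span of `H`. -/
noncomputable def canonicalCopy (H : CubeSubgraph) : CubeSubgraph :=
  ⟨H.span,
    { verts := H.restrict '' H.2.verts
      Adj := fun u v => ∃ x y, H.2.Adj x y ∧ H.restrict x = u ∧ H.restrict y = v
      adj_sub := by
        rintro u v ⟨x, y, h, rfl, rfl⟩
        exact H.restrict_adj h
      edge_vert := by
        rintro u v ⟨x, y, h, rfl, rfl⟩
        exact ⟨x, H.2.edge_vert h, rfl⟩
      symm := ⟨by
        rintro u v ⟨x, y, h, hx, hy⟩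
        exact ⟨y, x, h.symm, hy, hx⟩⟩ }⟩

/-- (Connected) cube subgraphs are ambient-isomorphic if they have the same canonical copy. -/
def AmbientIso (H K : CubeSubgraph) : Prop := H.canonicalCopy = K.canonicalCopy

/-- `β(H) = (2^s s!)⁻¹ (p / q²)^{e(H)} (1 / q)^{e'(H)}` with `s = span(H)` and `q = 1 - p`. -/
noncomputable def beta (p : ℝ) (H : CubeSubgraph) : ℝ :=
  1 / (2 ^ H.span * (H.span.factorial : ℝ)) * (p / (1 - p) ^ 2) ^ H.numEdges *
    (1 / (1 - p)) ^ H.numMissingEdges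

end CubeSubgraph

/-! ### The random subgraph `Q_p^d` -/

/-- Sample space for the random subgraph of `Q^d`: each edge is either open or closed. -/
abbrev EdgeConfig (d : ℕ) : Type := (hypercube d).edgeSet → Bool

/-- The law of `Q_p^d`: edges are open independently with probability `p`. -/
noncomputable def edgeMeasure (p : unitInterval) (d : ℕ) : Measure (EdgeConfig d) :=
  Measure.pi fun _ => bernoulliMeasure true false p

instance edgeMeasure.isProbabilityMeasure (p : unitInterval) (d : ℕ) :
    IsProbabilityMeasure (edgeMeasure p d) := by
  unfold edgeMeasure
  infer_instance

/-- The spanning subgraph of `Q^d` formed by the open edges. -/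
def openGraph {d : ℕ} (ω : EdgeConfig d) : SimpleGraph (Fin d → Bool) where
  Adj x y := ∃ h : (hypercube d).Adj x y, ω ⟨s(x, y), h⟩ = true
  symm := ⟨by
    rintro x y ⟨h, hω⟩
    refine ⟨h.symm, ?_⟩
    rw [← hω]
    congr 2
    exact Sym2.eq_swap⟩
  loopless := ⟨fun x h => (hypercube d).loopless.irrefl x h.1⟩

/-- A component of the open graph, as a cube subgraph. -/
def componentSubgraph {d : ℕ} (ω : EdgeConfig d) (C : (openGraph ω).ConnectedComponent) :
    CubeSubgraph :=
  ⟨d,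
    { verts := C.supp
      Adj := fun x y => (openGraph ω).Adj x y ∧ x ∈ C.supp
      adj_sub := fun h => h.1.1
      edge_vert := fun h => h.2
      symm := ⟨fun _ _ h => ⟨h.1.symm, (C.mem_supp_congr_adj h.1).1 h.2⟩⟩ }⟩

/-- The number of components of the open graph that are ambient-isomorphic to `H`. -/
noncomputable def componentCount (H : CubeSubgraph) {d : ℕ} (ω : EdgeConfig d) : ℕ :=
  Nat.card {C : (openGraph ω).ConnectedComponent //
    CubeSubgraph.AmbientIso (componentSubgraph ω C) H}

/-! ### Asymptotic and probabilistic notions -/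

/-- `m_p = ⌊1 / log₂ (1 / q)⌋`, where `q = 1 - p`. -/
noncomputable def maxSmallSize (p : ℝ) : ℕ := ⌊1 / Real.logb 2 (1 / (1 - p))⌋₊

/-- The events `E d` hold with very high probability, i.e. with probability `1 - e^{-Ω(d)}`. -/
def WithVeryHighProb (p : unitInterval) (E : ∀ d, Set (EdgeConfig d)) : Prop :=
  ∃ γ : ℝ, 0 < γ ∧ ∀ᶠ d : ℕ in atTop, 1 - Real.exp (-(γ * d)) ≤ (edgeMeasure p d).real (E d)

/-- `f = (1 + O(h)) g` as `d → ∞`. -/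
def EqOneAddBigOMul (f h g : ℕ → ℝ) : Prop :=
  ∃ η : ℕ → ℝ, η =O[atTop] h ∧ ∀ᶠ d in atTop, f d = (1 + η d) * g d

/-- Total variation distance `½ ∑ₖ |μ{k} - ν{k}|` of two probability measures on `ℕ`. -/
noncomputable def tvDist (μ ν : Measure ℕ) : ℝ := 1 / 2 * ∑' k : ℕ, |μ.real {k} - ν.real {k}|

/-! ### The Stein equation of the Poisson distribution -/

section SteinEquation

variable {l : ℝ} {w a : ℕ → ℝ}

/-! `Y` is the sum, over all copies `G` of the `H i` in `Q^d`, of the indicator that `G` is a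
component. That event prescribes exactly the `d v - e - e'` cube edges meeting `G`, of which `e` are
open, so its probability is `(p/q²)^e (1/q)^e' q^(vd)`. A copy is fixed by its set of free
directions and its values on the other coordinates, so there are `(d choose span) 2^(d - span)` of
them. Hence `λ` is the sum of `β(H i) (d)_span (2 q^v)^d`, dominated by the smallest size and,
within it, the largest span.

Copies with no common touching edge have independent indicators. Two distinct copies that share a
vertex cannot both be components. If their vertex sets are disjoint, they share at most `v v'`
touching edges, so their joint probability is at most `p^(-v v')` times the product
(`integral_compIndicator_mul_le`). The expected number of components near a given copy is `O(d^(span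
+ 1) q^(vd))`; as `span < v` (`span_lt_size`), this is `O((d q^d)^t)`. The Stein–Chen method, with
the bound `1/λ` on the increments of the Stein solution, turns these facts into `d_TV(Y, Po(λ)) =
O((d q^d)^t)`; the same pair sums control `Var(Y) - λ`.

Everything else is transferred from the Poisson law. Since `t ≤ m_p` means `2 q^t ≥ 1`, `λ` grows at
least linearly in `d`, so Poisson deviations of order `√(dλ)` have exponentially small probability,
as has the total variation error. The central limit theorem follows from convergence of Poisson
characteristic functions and from `Var(Y) ~ λ`. -/

theorem mul_sum_range_le_of_recursion (hw : ∀ k, 0 ≤ w k)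
    (hrec : ∀ k : ℕ, ((k : ℝ) + 1) * w (k + 1) = l * w k) (k : ℕ) :
    l * ∑ i ∈ Finset.range k, w i ≤ k * ∑ i ∈ Finset.range (k + 1), w i := by
  induction k with
  | zero => simp
  | succ k ih =>
    rw [Finset.sum_range_succ, mul_add, ← hrec k, Finset.sum_range_succ _ (k + 1)]
    have : 0 ≤ ∑ i ∈ Finset.range (k + 1), w i := Finset.sum_nonneg fun i _ => hw i
    push_cast
    nlinarith

/-- Termwise comparison: for `i ≥ k`, `k w (i + 1) ≤ (i + 1) w (i + 1) = l w i`. With the companion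
bound for initial segments, it says that the solution for a point mass at `j` decreases at every
positive step except from `j` to `j + 1`. -/
theorem mul_tail_le_of_recursion (hw : ∀ k, 0 ≤ w k) (hs : HasSum w 1)
    (hrec : ∀ k : ℕ, ((k : ℝ) + 1) * w (k + 1) = l * w k) (k : ℕ) :
    k * (1 - ∑ i ∈ Finset.range (k + 1), w i) ≤ l * (1 - ∑ i ∈ Finset.range k, w i) := by
  have tail : ∀ m, 1 - ∑ i ∈ Finset.range m, w i = ∑' i, w (i + m) := fun m => by
    rw [← hs.tsum_eq, ← hs.summable.sum_add_tsum_nat_add m]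
    ring
  rw [tail, tail, ← tsum_mul_left, ← tsum_mul_left]
  refine Summable.tsum_le_tsum (fun i => ?_) (((summable_nat_add_iff (k + 1)).2 hs.summable).mul_left _)
    (((summable_nat_add_iff k).2 hs.summable).mul_left _)
  rw [← hrec (i + k), ← add_assoc]
  refine mul_le_mul_of_nonneg_right ?_ (hw _)
  push_cast
  have : (0 : ℝ) ≤ i := Nat.cast_nonneg i
  linarith

/-- The solution of the Stein equation for the weights `w`, with right hand side `a / w`. -/
noncomputable def steinSolution (w a : ℕ → ℝ) (k : ℕ) : ℝ :=
  (∑ i ∈ Finset.range k, a i - (∑' i, a i) * ∑ i ∈ Finset.range k, w i) / (k * w k)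

theorem steinSolution_equation (hw : ∀ k, 0 < w k)
    (hrec : ∀ k : ℕ, ((k : ℝ) + 1) * w (k + 1) = l * w k) (hl : 0 < l) (k : ℕ) :
    l * steinSolution w a (k + 1) - k * steinSolution w a k = a k / w k - ∑' i, a i := by
  have h1 : l * steinSolution w a (k + 1) =
      (∑ i ∈ Finset.range (k + 1), a i - (∑' i, a i) * ∑ i ∈ Finset.range (k + 1), w i) / w k := by
    have := (hw k).ne'
    rw [steinSolution]
    push_cast
    rw [hrec k]
    field_simp
  have h2 : k * steinSolution w a k =
      (∑ i ∈ Finset.range k, a i - (∑' i, a i) * ∑ i ∈ Finset.range k, w i) / w k := by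
    have := (hw k).ne'
    -- The solution at `0` is a junk value from division by zero; the factor `k` removes it.
    rcases Nat.eq_zero_or_pos k with rfl | hk
    · simp
    · have : (k : ℝ) ≠ 0 := by positivity
      rw [steinSolution]
      field_simp
  have := (hw k).ne'
  rw [h1, h2, Finset.sum_range_succ, Finset.sum_range_succ]
  field_simp
  ring

/-- The increment is linear in `a`. The mass of `a` below `k` and the mass above `k` both contribute
nonpositively, by the two recursion bounds, so only `a k ≤ w k` can push it up, and by at most `1 /
l`. -/
theorem steinSolution_sub_le (hw : ∀ k, 0 < w k) (hs : HasSum w 1)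
    (hrec : ∀ k : ℕ, ((k : ℝ) + 1) * w (k + 1) = l * w k) (hl : 0 < l)
    (ha : ∀ k, 0 ≤ a k) (haw : ∀ k, a k ≤ w k) {k : ℕ} (hk : 1 ≤ k) :
    steinSolution w a (k + 1) - steinSolution w a k ≤ 1 / l := by
  have has : Summable a := hs.summable.of_nonneg_of_le ha haw
  have h1 := mul_sum_range_le_of_recursion (fun k => (hw k).le) hrec k
  have h2 := mul_tail_le_of_recursion (fun k => (hw k).le) hs hrec k
  have hB := has.sum_le_tsum (Finset.range (k + 1)) fun i _ => ha i
  have hA : 0 ≤ ∑ i ∈ Finset.range k, a i := Finset.sum_nonneg fun i _ => ha i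
  have hk0 : (0 : ℝ) < k := by exact_mod_cast hk
  have hF : 0 ≤ ∑ i ∈ Finset.range k, w i := Finset.sum_nonneg fun i _ => (hw i).le
  have hT := hs.summable.sum_le_tsum (Finset.range (k + 1)) fun i _ => (hw i).le
  rw [hs.tsum_eq] at hT
  have hwk := hw k
  have hak := ha k
  have hakw := haw k
  have e : steinSolution w a (k + 1) - steinSolution w a k =
      ((∑ i ∈ Finset.range (k + 1), a i - (∑' i, a i) * ∑ i ∈ Finset.range (k + 1), w i) * k -
        (∑ i ∈ Finset.range k, a i - (∑' i, a i) * ∑ i ∈ Finset.range k, w i) * l) /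
        (l * k * w k) := by
    have h0 := hwk.ne'
    rw [steinSolution, steinSolution]
    push_cast
    rw [hrec k]
    field_simp
  rw [e, div_le_div_iff₀ (by positivity) hl]
  rw [Finset.sum_range_succ] at *
  rw [Finset.sum_range_succ] at *
  generalize ∑ i ∈ Finset.range k, a i = A at *
  generalize ∑ i ∈ Finset.range k, w i = F at *
  generalize (∑' i, a i) = S at *
  clear e
  generalize a k = e at *
  generalize w k = x at *
  generalize (k : ℝ) = m at *
  -- `A`, `e` and `B` are the masses of `a` below, at and above `k`; `i1`, `i2` and `i3` bound their
  -- coefficients.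
  obtain ⟨B, rfl⟩ : ∃ B, S = A + e + B := ⟨S - (A + e), by ring⟩
  have hB' : 0 ≤ B := by linarith
  have key : ((A + e - (A + e + B) * (F + x)) * m - (A - (A + e + B) * F) * l) ≤ m * x := by
    have i1 := mul_nonneg hA (sub_nonneg.2 h2)
    have i2 := mul_nonneg hB' (sub_nonneg.2 h1)
    have i3 : e * (m * (1 - (F + x)) + l * F) ≤ x * m := by
      calc e * (m * (1 - (F + x)) + l * F) ≤ e * m :=
            mul_le_mul_of_nonneg_left (by nlinarith) hak
        _ ≤ x * m := mul_le_mul_of_nonneg_right hakw hk0.le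
    nlinarith
  calc _ ≤ m * x * l := mul_le_mul_of_nonneg_right key hl.le
    _ = 1 * (l * m * x) := by ring

theorem steinSolution_sub_eq_neg (ha : Summable a) (hs : HasSum w 1) (k : ℕ) :
    steinSolution w (fun i => w i - a i) k = - steinSolution w a k := by
  rw [steinSolution, steinSolution, hs.summable.tsum_sub ha, hs.tsum_eq, Finset.sum_sub_distrib]
  ring

/-- The lower bound on the increments is the upper bound for the complementary function `1 - h`,
whose solution is `-f`. -/
theorem exists_stein_solution (hw : ∀ k, 0 < w k) (hs : HasSum w 1)
    (hrec : ∀ k : ℕ, ((k : ℝ) + 1) * w (k + 1) = l * w k) (hl : 0 < l) {h : ℕ → ℝ}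
    (h0 : ∀ k, 0 ≤ h k) (h1 : ∀ k, h k ≤ 1) :
    ∃ f : ℕ → ℝ, (∀ k : ℕ, l * f (k + 1) - k * f k = h k - ∑' i, w i * h i) ∧
      ∀ k, 1 ≤ k → |f (k + 1) - f k| ≤ 1 / l := by
  have ha : ∀ k, 0 ≤ w k * h k := fun k => mul_nonneg (hw k).le (h0 k)
  have haw : ∀ k, w k * h k ≤ w k := fun k => mul_le_of_le_one_right (hw k).le (h1 k)
  refine ⟨steinSolution w fun i => w i * h i, fun k => ?_, fun k hk => abs_le.2 ⟨?_, ?_⟩⟩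
  · rw [steinSolution_equation hw hrec hl, mul_div_cancel_left₀ _ (hw k).ne']
  · have := steinSolution_sub_le (a := fun i => w i - w i * h i) hw hs hrec hl
      (fun k => sub_nonneg.2 (haw k)) (fun k => sub_le_self _ (ha k)) hk
    rw [steinSolution_sub_eq_neg (hs.summable.of_nonneg_of_le ha haw) hs,
      steinSolution_sub_eq_neg (hs.summable.of_nonneg_of_le ha haw) hs] at this
    linarith
  · exact steinSolution_sub_le hw hs hrec hl ha haw hk

end SteinEquation

theorem abs_sub_le_mul_of_abs_succ_sub_le {f : ℕ → ℝ} {D : ℝ}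
    (hf : ∀ k, 1 ≤ k → |f (k + 1) - f k| ≤ D) {m : ℕ} (hm : 1 ≤ m) (j : ℕ) :
    |f (m + j) - f m| ≤ D * j := by
  induction j with
  | zero => simp
  | succ j ih =>
    have := hf (m + j) (by omega)
    calc |f (m + (j + 1)) - f m| = |(f (m + j + 1) - f (m + j)) + (f (m + j) - f m)| := by
          rw [sub_add_sub_cancel, add_assoc]
      _ ≤ D + D * j := (abs_add_le _ _).trans (add_le_add this ih)
      _ = D * ((j + 1 : ℕ) : ℝ) := by push_cast; ring

/-! ### Total variation distance -/

theorem hasSum_measureReal_singleton (μ : Measure ℕ) [IsProbabilityMeasure μ] :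
    HasSum (fun k => μ.real {k}) 1 := by
  have h : Integrable (fun _ : ℕ => (1 : ℝ)) μ := integrable_const _
  have h1 := integral_countable h
  have h2 : Summable fun k => μ.real {k} := by
    have h3 := measure_iUnion (μ := μ) (f := fun k : ℕ => ({k} : Set ℕ))
      (fun i j hij => by simpa [Function.onFun] using hij) fun k => MeasurableSet.singleton k
    rw [Set.iUnion_of_singleton, measure_univ] at h3
    exact ENNReal.summable_toReal (by rw [← h3]; simp)
  have h3 : 1 = ∑' k, μ.real {k} := by simpa using h1
  rw [h3]
  exact h2.hasSum

theorem integral_eq_tsum_of_bounded (μ : Measure ℕ) [IsProbabilityMeasure μ] {g : ℕ → ℝ} {C : ℝ}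
    (hg : ∀ k, |g k| ≤ C) : ∫ k, g k ∂μ = ∑' k, μ.real {k} * g k := by
  rw [integral_countable]
  · simp
  · exact Integrable.of_bound (by fun_prop) C (ae_of_all _ hg)

theorem exists_tvDist_eq (μ ν : Measure ℕ) [IsProbabilityMeasure μ] [IsProbabilityMeasure ν] :
    ∃ h : ℕ → ℝ, (∀ k, 0 ≤ h k) ∧ (∀ k, h k ≤ 1) ∧
      tvDist μ ν = ∫ k, h k ∂μ - ∑' k, ν.real {k} * h k := by
  classical
  -- The optimal test function: since both measures have mass one, half the `ℓ¹` distance is the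
  -- positive part of the difference.
  let h : ℕ → ℝ := fun k => if ν.real {k} ≤ μ.real {k} then 1 else 0
  have hμ := hasSum_measureReal_singleton μ
  have hν := hasSum_measureReal_singleton ν
  have h0 : ∀ k, 0 ≤ h k := fun k => by dsimp [h]; split_ifs <;> norm_num
  have h1 : ∀ k, h k ≤ 1 := fun k => by dsimp [h]; split_ifs <;> norm_num
  refine ⟨h, h0, h1, ?_⟩
  rw [integral_eq_tsum_of_bounded μ (C := 1) fun k => abs_le.2 ⟨by linarith [h0 k], h1 k⟩]
  have sμ : Summable fun k => μ.real {k} * h k :=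
    hμ.summable.of_nonneg_of_le (fun k => mul_nonneg measureReal_nonneg (h0 k))
      fun k => mul_le_of_le_one_right measureReal_nonneg (h1 k)
  have sν : Summable fun k => ν.real {k} * h k :=
    hν.summable.of_nonneg_of_le (fun k => mul_nonneg measureReal_nonneg (h0 k))
      fun k => mul_le_of_le_one_right measureReal_nonneg (h1 k)
  have e : (fun k => |μ.real {k} - ν.real {k}|) =
      fun k => 2 * (μ.real {k} * h k - ν.real {k} * h k) - (μ.real {k} - ν.real {k}) := by
    ext k
    dsimp [h]
    split_ifs with hk
    · rw [abs_of_nonneg (sub_nonneg.2 hk)]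
      ring
    · rw [abs_of_neg (sub_neg.2 (not_le.1 hk))]
      ring
  rw [tvDist, e, Summable.tsum_sub ((sμ.sub sν).mul_left 2) (hμ.summable.sub hν.summable),
    tsum_mul_left, sμ.tsum_sub sν, hμ.summable.tsum_sub hν.summable, hμ.tsum_eq, hν.tsum_eq]
  ring

/-- Vector-valued so as to serve both for indicators of sets and for the complex exponentials of
characteristic functions. -/
theorem norm_integral_sub_integral_le_tvDist (μ ν : Measure ℕ) [IsProbabilityMeasure μ]
    [IsProbabilityMeasure ν] {E : Type*} [NormedAddCommGroup E] [NormedSpace ℝ E]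
    [CompleteSpace E] {g : ℕ → E} (hg : ∀ k, ‖g k‖ ≤ 1) :
    ‖∫ k, g k ∂μ - ∫ k, g k ∂ν‖ ≤ 2 * tvDist μ ν := by
  have hμ := (hasSum_measureReal_singleton μ).summable
  have hν := (hasSum_measureReal_singleton ν).summable
  have iμ : Integrable g μ := Integrable.of_bound (by fun_prop) 1 (ae_of_all _ hg)
  have iν : Integrable g ν := Integrable.of_bound (by fun_prop) 1 (ae_of_all _ hg)
  have key : ∀ ρ : Measure ℕ, Summable (fun k => ρ.real {k}) →
      Summable fun k => ρ.real {k} • g k := fun ρ hρ => by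
    refine Summable.of_norm_bounded hρ fun k => ?_
    rw [norm_smul, Real.norm_of_nonneg measureReal_nonneg]
    exact mul_le_of_le_one_right measureReal_nonneg (hg k)
  have hd := (hμ.sub hν).abs
  rw [integral_countable iμ, integral_countable iν, ← (key μ hμ).tsum_sub (key ν hν), tvDist]
  calc ‖∑' k, (μ.real {k} • g k - ν.real {k} • g k)‖ ≤ ∑' k, |μ.real {k} - ν.real {k}| := by
        refine tsum_of_norm_bounded hd.hasSum fun k => ?_
        rw [← sub_smul, norm_smul]
        exact mul_le_of_le_one_right (abs_nonneg _) (hg k)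
    _ = _ := by ring

theorem measureReal_le_add_tvDist (μ ν : Measure ℕ) [IsProbabilityMeasure μ]
    [IsProbabilityMeasure ν] (S : Set ℕ) : μ.real S ≤ ν.real S + 2 * tvDist μ ν := by
  have h := norm_integral_sub_integral_le_tvDist μ ν (g := S.indicator fun _ => (1 : ℝ)) fun k =>
    (norm_indicator_le_norm_self _ _).trans (by simp)
  rw [integral_indicator_const _ (by measurability), integral_indicator_const _ (by measurability),
    Real.norm_eq_abs] at h
  have := le_abs_self (μ.real S • (1 : ℝ) - ν.real S • (1 : ℝ))
  simp only [smul_eq_mul, mul_one] at this h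
  linarith

theorem tvDist_nonneg (μ ν : Measure ℕ) : 0 ≤ tvDist μ ν :=
  mul_nonneg (by norm_num) (tsum_nonneg fun _ => abs_nonneg _)

/-! ### The Stein–Chen method for sums of locally dependent indicators -/

section SteinChen

variable {Ω : Type*} [MeasurableSpace Ω] [Finite Ω] [MeasurableSingletonClass Ω]
  {μ : Measure Ω} [IsProbabilityMeasure μ] {ι : Type*} [Fintype ι] [DecidableEq ι]
  {X : ι → Ω → ℕ} {N : ι → Finset ι}

/-- Let `V` be the sum outside the neighbourhood of `i`; it is independent of `X i`. Both terms are
compared with the expectation of `X i * f (V + 1)`. In the first the argument moves by the sum over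
`N i`; in the second, where only `X i = 1` matters, the extra `1` is `X i` itself and the argument
moves by the sum over `N i` without `i`. -/
theorem abs_integral_stein_summand_le (hX : ∀ i ω, X i ω ≤ 1) {f : ℕ → ℝ} {D : ℝ}
    (hf : ∀ k, 1 ≤ k → |f (k + 1) - f k| ≤ D) (i : ι) (hN : i ∈ N i)
    (hind : IndepFun (X i) (fun ω (j : {j // j ∉ N i}) => X j ω) μ) :
    |(∫ ω, (X i ω : ℝ) ∂μ) * (∫ ω, f (∑ j, X j ω + 1) ∂μ) -
        ∫ ω, (X i ω : ℝ) * f (∑ j, X j ω) ∂μ| ≤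
      D * (∑ j ∈ N i, (∫ ω, (X i ω : ℝ) ∂μ) * ∫ ω, (X j ω : ℝ) ∂μ +
        ∑ j ∈ (N i).erase i, ∫ ω, (X i ω : ℝ) * X j ω ∂μ) := by
  have int : ∀ g : Ω → ℝ, Integrable g μ := fun g => Integrable.of_finite
  set V : Ω → ℕ := fun ω => ∑ j : {j // j ∉ N i}, X j ω with hV
  have hW : ∀ ω, ∑ j, X j ω = V ω + ∑ j ∈ N i, X j ω := fun ω => by
    have h := Finset.sum_subtype (Finset.univ \ N i) (p := (· ∉ N i)) (F := inferInstance)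
      (by simp) fun j => X j ω
    rw [← Finset.sum_sdiff (Finset.subset_univ (N i)), h]
  have hindep : ∫ ω, (X i ω : ℝ) * f (V ω + 1) ∂μ =
      (∫ ω, (X i ω : ℝ) ∂μ) * ∫ ω, f (V ω + 1) ∂μ := by
    refine IndepFun.integral_fun_mul_eq_mul_integral (X := fun ω => (X i ω : ℝ))
      (Y := fun ω => f (V ω + 1)) ?_ (int _).1 (int _).1
    have hψ : Measurable fun x : {j // j ∉ N i} → ℕ => f (∑ j, x j + 1) :=
      (Measurable.of_discrete (f := fun n : ℕ => f (n + 1))).comp (by fun_prop)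
    exact hind.comp (φ := fun n : ℕ => (n : ℝ)) Measurable.of_discrete hψ
  have hp : 0 ≤ ∫ ω, (X i ω : ℝ) ∂μ := integral_nonneg fun ω => Nat.cast_nonneg _
  have h1 : |∫ ω, f (∑ j, X j ω + 1) ∂μ - ∫ ω, f (V ω + 1) ∂μ| ≤
      D * ∑ j ∈ N i, ∫ ω, (X j ω : ℝ) ∂μ := by
    rw [← integral_sub (int _) (int _), ← integral_finsetSum _ fun j _ => int _,
      ← integral_const_mul]
    refine abs_integral_le_integral_abs.trans (integral_mono (int _) (int _) fun ω => ?_)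
    have := abs_sub_le_mul_of_abs_succ_sub_le hf (m := V ω + 1) (by omega) (∑ j ∈ N i, X j ω)
    dsimp only
    rw [hW, show V ω + ∑ j ∈ N i, X j ω + 1 = V ω + 1 + ∑ j ∈ N i, X j ω by ring]
    simpa using this
  have h2 : |∫ ω, (X i ω : ℝ) * f (V ω + 1) ∂μ - ∫ ω, (X i ω : ℝ) * f (∑ j, X j ω) ∂μ| ≤
      D * ∑ j ∈ (N i).erase i, ∫ ω, (X i ω : ℝ) * X j ω ∂μ := by
    rw [← integral_sub (int _) (int _), ← integral_finsetSum _ fun j _ => int _,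
      ← integral_const_mul]
    refine abs_integral_le_integral_abs.trans (integral_mono (int _) (int _) fun ω => ?_)
    dsimp only
    rcases Nat.le_one_iff_eq_zero_or_eq_one.1 (hX i ω) with h | h
    · simp [h]
    · have := abs_sub_le_mul_of_abs_succ_sub_le hf (m := V ω + 1) (by omega)
        (∑ j ∈ (N i).erase i, X j ω)
      rw [hW, ← Finset.add_sum_erase _ _ hN, h, ← add_assoc, abs_sub_comm, ← mul_sub, abs_mul]
      simpa using this
  calc _ = |(∫ ω, (X i ω : ℝ) ∂μ) * (∫ ω, f (∑ j, X j ω + 1) ∂μ - ∫ ω, f (V ω + 1) ∂μ) +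
        (∫ ω, (X i ω : ℝ) * f (V ω + 1) ∂μ - ∫ ω, (X i ω : ℝ) * f (∑ j, X j ω) ∂μ)| := by
        rw [hindep]
        ring_nf
    _ ≤ (∫ ω, (X i ω : ℝ) ∂μ) * (D * ∑ j ∈ N i, ∫ ω, (X j ω : ℝ) ∂μ) +
        D * ∑ j ∈ (N i).erase i, ∫ ω, (X i ω : ℝ) * X j ω ∂μ := by
        refine (abs_add_le _ _).trans (add_le_add ?_ h2)
        rw [abs_mul, abs_of_nonneg hp]
        exact mul_le_mul_of_nonneg_left h1 hp
    _ = _ := by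
        rw [← Finset.mul_sum]
        ring

variable {K δ : ℝ}

omit [Finite Ω] [MeasurableSingletonClass Ω] [IsProbabilityMeasure μ] [Fintype ι] in
theorem sum_dependency_le (hK : 0 ≤ K)
    (hδ : ∀ i, ∑ j ∈ N i, ∫ ω, (X j ω : ℝ) ∂μ ≤ δ)
    (hpair : ∀ i, ∀ j ∈ N i, j ≠ i → ∫ ω, (X i ω : ℝ) * X j ω ∂μ ≤
      K * ((∫ ω, (X i ω : ℝ) ∂μ) * ∫ ω, (X j ω : ℝ) ∂μ)) (i : ι) :
    ∑ j ∈ N i, (∫ ω, (X i ω : ℝ) ∂μ) * ∫ ω, (X j ω : ℝ) ∂μ +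
        ∑ j ∈ (N i).erase i, ∫ ω, (X i ω : ℝ) * X j ω ∂μ ≤
      (1 + K) * δ * ∫ ω, (X i ω : ℝ) ∂μ := by
  have hp : ∀ j, 0 ≤ ∫ ω, (X j ω : ℝ) ∂μ := fun j => integral_nonneg fun ω => Nat.cast_nonneg _
  have h2 : ∑ j ∈ (N i).erase i, ∫ ω, (X i ω : ℝ) * X j ω ∂μ ≤
      K * ∑ j ∈ N i, (∫ ω, (X i ω : ℝ) ∂μ) * ∫ ω, (X j ω : ℝ) ∂μ := by
    rw [Finset.mul_sum]
    refine (Finset.sum_le_sum fun j hj => hpair i j (Finset.mem_of_mem_erase hj)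
      (Finset.ne_of_mem_erase hj)).trans
      (Finset.sum_le_sum_of_subset_of_nonneg (Finset.erase_subset _ _) fun j _ _ => ?_)
    exact mul_nonneg hK (mul_nonneg (hp i) (hp j))
  have h1 : ∑ j ∈ N i, (∫ ω, (X i ω : ℝ) ∂μ) * ∫ ω, (X j ω : ℝ) ∂μ ≤
      δ * ∫ ω, (X i ω : ℝ) ∂μ := by
    rw [← Finset.mul_sum, mul_comm]
    exact mul_le_mul_of_nonneg_right (hδ i) (hp i)
  nlinarith

/-- Each summand costs at most `(1 + K) δ / l` times its mean; the means add up to `l`, which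
cancels the Stein factor `1 / l`. -/
theorem tvDist_sum_indicators_poisson_le (hX : ∀ i ω, X i ω ≤ 1) (hN : ∀ i, i ∈ N i)
    (hind : ∀ i, IndepFun (X i) (fun ω (j : {j // j ∉ N i}) => X j ω) μ) (hK : 0 ≤ K)
    (hδ : ∀ i, ∑ j ∈ N i, ∫ ω, (X j ω : ℝ) ∂μ ≤ δ)
    (hpair : ∀ i, ∀ j ∈ N i, j ≠ i → ∫ ω, (X i ω : ℝ) * X j ω ∂μ ≤
      K * ((∫ ω, (X i ω : ℝ) ∂μ) * ∫ ω, (X j ω : ℝ) ∂μ))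
    {l : ℝ} (hl : l = ∫ ω, ((∑ i, X i ω : ℕ) : ℝ) ∂μ) (hl0 : 0 < l) :
    tvDist (μ.map fun ω => ∑ i, X i ω) (poissonMeasure l.toNNReal) ≤ (1 + K) * δ := by
  have int : ∀ g : Ω → ℝ, Integrable g μ := fun g => Integrable.of_finite
  have hWm : Measurable fun ω => ∑ i, X i ω := Measurable.of_discrete
  have := Measure.isProbabilityMeasure_map (μ := μ) hWm.aemeasurable
  obtain ⟨h, h0, h1, htv⟩ := exists_tvDist_eq (μ.map fun ω => ∑ i, X i ω)
    (poissonMeasure l.toNNReal)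
  have hw : ∀ k, (poissonMeasure l.toNNReal).real {k} = Real.exp (-l) * l ^ k / k.factorial :=
    fun k => by rw [poissonMeasure_real_singleton, Real.coe_toNNReal _ hl0.le]
  obtain ⟨f, hfe, hfd⟩ := exists_stein_solution (l := l)
    (w := fun k => (poissonMeasure l.toNNReal).real {k})
    (fun k => by rw [hw]; positivity) (hasSum_measureReal_singleton _)
    (fun k => by
      rw [hw, hw, pow_succ, Nat.factorial_succ]
      push_cast
      have : (k.factorial : ℝ) ≠ 0 := by positivity
      have : (k : ℝ) + 1 ≠ 0 := by positivity
      field_simp) hl0 h0 h1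
  have hls : l = ∑ i, ∫ ω, (X i ω : ℝ) ∂μ := by
    rw [hl, ← integral_finsetSum _ fun i _ => int _]
    simp
  rw [htv, integral_map hWm.aemeasurable (by fun_prop)]
  have e1 : ∫ ω, h (∑ i, X i ω) ∂μ - ∑' k, (poissonMeasure l.toNNReal).real {k} * h k =
      ∫ ω, (l * f (∑ i, X i ω + 1) - (∑ i, X i ω : ℕ) * f (∑ i, X i ω)) ∂μ := by
    simp_rw [hfe]
    rw [integral_sub (int _) (int _)]
    simp
  have e2 : ∫ ω, (l * f (∑ i, X i ω + 1) - (∑ i, X i ω : ℕ) * f (∑ i, X i ω)) ∂μ =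
      ∑ i, ((∫ ω, (X i ω : ℝ) ∂μ) * (∫ ω, f (∑ j, X j ω + 1) ∂μ) -
        ∫ ω, (X i ω : ℝ) * f (∑ j, X j ω) ∂μ) := by
    rw [integral_sub (int _) (int _), integral_const_mul, Finset.sum_sub_distrib,
      ← Finset.sum_mul, ← hls, ← integral_finsetSum _ fun i _ => int _]
    simp only [Nat.cast_sum, Finset.sum_mul]
  rw [e1, e2]
  refine (le_abs_self _).trans ((Finset.abs_sum_le_sum_abs _ _).trans ?_)
  calc
    _ ≤ ∑ i, 1 / l * ((1 + K) * δ * ∫ ω, (X i ω : ℝ) ∂μ) := by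
      refine Finset.sum_le_sum fun i _ =>
        (abs_integral_stein_summand_le hX hfd i (hN i) (hind i)).trans
          (mul_le_mul_of_nonneg_left ?_ (by positivity))
      exact sum_dependency_le hK hδ hpair i
    _ = (1 + K) * δ := by
      rw [← Finset.mul_sum, ← Finset.mul_sum, ← hls]
      field_simp

/-- Covariances outside the neighbourhoods vanish, and `X i ^ 2 = X i` makes the diagonal second
moments add up to `l`. What remains are the pair sums of the Stein–Chen bound. -/
theorem abs_variance_sum_indicators_sub_le (hX : ∀ i ω, X i ω ≤ 1) (hN : ∀ i, i ∈ N i)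
    (hind : ∀ i, IndepFun (X i) (fun ω (j : {j // j ∉ N i}) => X j ω) μ) (hK : 0 ≤ K)
    (hδ : ∀ i, ∑ j ∈ N i, ∫ ω, (X j ω : ℝ) ∂μ ≤ δ)
    (hpair : ∀ i, ∀ j ∈ N i, j ≠ i → ∫ ω, (X i ω : ℝ) * X j ω ∂μ ≤
      K * ((∫ ω, (X i ω : ℝ) ∂μ) * ∫ ω, (X j ω : ℝ) ∂μ))
    {l : ℝ} (hl : l = ∫ ω, ((∑ i, X i ω : ℕ) : ℝ) ∂μ) :
    |variance (fun ω => ((∑ i, X i ω : ℕ) : ℝ)) μ - l| ≤ (1 + K) * δ * l := by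
  have int : ∀ g : Ω → ℝ, Integrable g μ := fun g => Integrable.of_finite
  have mem : ∀ g : Ω → ℝ, MemLp g 2 μ := fun g => MemLp.of_discrete
  have hls : l = ∑ i, ∫ ω, (X i ω : ℝ) ∂μ := by
    rw [hl, ← integral_finsetSum _ fun i _ => int _]
    simp
  have hp : ∀ j, 0 ≤ ∫ ω, (X j ω : ℝ) ∂μ := fun j => integral_nonneg fun ω => Nat.cast_nonneg _
  have hvar : variance (fun ω => ((∑ i, X i ω : ℕ) : ℝ)) μ =
      ∑ i, ∑ j, cov[fun ω => (X i ω : ℝ), fun ω => (X j ω : ℝ); μ] := by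
    rw [← variance_sum fun i => mem _]
    congr 1
    ext ω
    simp
  have hcov : ∀ i j, cov[fun ω => (X i ω : ℝ), fun ω => (X j ω : ℝ); μ] =
      ∫ ω, (X i ω : ℝ) * X j ω ∂μ - (∫ ω, (X i ω : ℝ) ∂μ) * ∫ ω, (X j ω : ℝ) ∂μ := fun i j => by
    rw [covariance_eq_sub (mem _) (mem _)]
    rfl
  rw [hvar]
  nth_rw 1 [hls]
  rw [← Finset.sum_sub_distrib]
  refine (Finset.abs_sum_le_sum_abs _ _).trans ?_
  calc
    _ ≤ ∑ i, (1 + K) * δ * ∫ ω, (X i ω : ℝ) ∂μ := by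
      refine Finset.sum_le_sum fun i _ => le_trans ?_ (sum_dependency_le hK hδ hpair i)
      have h0 : ∀ j ∉ N i, cov[fun ω => (X i ω : ℝ), fun ω => (X j ω : ℝ); μ] = 0 := fun j hj => by
        refine IndepFun.covariance_eq_zero ?_ (mem _) (mem _)
        have hψ : Measurable fun x : {j // j ∉ N i} → ℕ => (x ⟨j, hj⟩ : ℝ) :=
          (Measurable.of_discrete (f := fun n : ℕ => (n : ℝ))).comp (measurable_pi_apply _)
        exact (hind i).comp (φ := fun n : ℕ => (n : ℝ)) Measurable.of_discrete hψ
      have hii : ∫ ω, (X i ω : ℝ) * X i ω ∂μ = ∫ ω, (X i ω : ℝ) ∂μ := by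
        congr 1
        ext ω
        rcases Nat.le_one_iff_eq_zero_or_eq_one.1 (hX i ω) with h | h <;> simp [h]
      rw [← Finset.sum_subset (Finset.subset_univ (N i)) fun j _ hj => h0 j hj]
      simp_rw [hcov]
      rw [Finset.sum_sub_distrib, ← Finset.add_sum_erase _ _ (hN i), hii]
      have a1 : 0 ≤ ∑ j ∈ N i, (∫ ω, (X i ω : ℝ) ∂μ) * ∫ ω, (X j ω : ℝ) ∂μ :=
        Finset.sum_nonneg fun j _ => mul_nonneg (hp i) (hp j)
      have a2 : 0 ≤ ∑ j ∈ (N i).erase i, ∫ ω, (X i ω : ℝ) * X j ω ∂μ :=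
        Finset.sum_nonneg fun j _ => integral_nonneg fun ω => by positivity
      exact abs_le.2 ⟨by linarith, by linarith⟩
    _ = (1 + K) * δ * l := by rw [← Finset.mul_sum, ← hls]

end SteinChen

/-! ### Tails and normal approximation of the Poisson distribution -/

theorem integrable_exp_mul_poissonMeasure (r : NNReal) (θ : ℝ) :
    Integrable (fun k : ℕ => Real.exp (θ * k)) (poissonMeasure r) := by
  rw [integrable_poissonMeasure_iff]
  have h := (Real.summable_pow_div_factorial (r * Real.exp θ)).mul_left (Real.exp (-r))
  refine h.congr fun k => ?_
  rw [Real.norm_of_nonneg (Real.exp_pos _).le, mul_pow, ← Real.exp_nat_mul, mul_comm θ]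
  ring

theorem mgf_poissonMeasure (r : NNReal) (θ : ℝ) :
    mgf (fun k : ℕ => (k : ℝ)) (poissonMeasure r) θ = Real.exp (r * (Real.exp θ - 1)) := by
  rw [mgf, integral_poissonMeasure]
  have h : ∀ k : ℕ, (Real.exp (-r) * (r : ℝ) ^ k / k.factorial) • Real.exp (θ * k) =
      Real.exp (-r) * ((r * Real.exp θ) ^ k / k.factorial) := fun k => by
    rw [smul_eq_mul, mul_pow, ← Real.exp_nat_mul, mul_comm θ]
    ring
  simp_rw [h]
  rw [tsum_mul_left, (NormedSpace.expSeries_div_hasSum_exp ((r : ℝ) * Real.exp θ)).tsum_eq,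
    ← Real.exp_eq_exp_ℝ, ← Real.exp_add]
  ring_nf

theorem poissonMeasure_real_abs_sub_ge_le {l x : ℝ} (hl : 0 < l) (hx : 0 ≤ x) (hxl : x ≤ 2 * l) :
    (poissonMeasure l.toNNReal).real {k | x ≤ |(k : ℝ) - l|} ≤
      2 * Real.exp (-(x ^ 2 / (4 * l))) := by
  -- Chernoff's bound with `exp y - 1 ≤ y + y²` leaves the exponent `-θ x + l θ²` on both sides,
  -- least at this `θ`; the assumption `x ≤ 2 l` ensures `θ ≤ 1`.
  set θ : ℝ := x / (2 * l) with hθ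
  have hθ0 : 0 ≤ θ := by positivity
  have hθ1 : θ ≤ 1 := by rw [hθ, div_le_one (by positivity)]; exact hxl
  have hlc : (l.toNNReal : ℝ) = l := Real.coe_toNNReal _ hl.le
  have hxθ : x = 2 * l * θ := by rw [hθ]; field_simp
  have e : x ^ 2 / (4 * l) = l * θ ^ 2 := by rw [hxθ]; field_simp; ring
  have hexp : ∀ y : ℝ, |y| ≤ 1 → Real.exp y - 1 ≤ y + y ^ 2 := fun y hy => by
    have := (abs_le.1 (Real.abs_exp_sub_one_sub_id_le hy)).2
    linarith
  have h1 := measure_ge_le_exp_mul_mgf (μ := poissonMeasure l.toNNReal)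
    (X := fun k : ℕ => (k : ℝ)) (l + x) hθ0 (integrable_exp_mul_poissonMeasure _ _)
  have h2 := measure_le_le_exp_mul_mgf (μ := poissonMeasure l.toNNReal)
    (X := fun k : ℕ => (k : ℝ)) (l - x) (neg_nonpos.2 hθ0) (integrable_exp_mul_poissonMeasure _ _)
  rw [mgf_poissonMeasure, hlc, ← Real.exp_add] at h1 h2
  have b1 : (poissonMeasure l.toNNReal).real {k | l + x ≤ (k : ℝ)} ≤
      Real.exp (-(x ^ 2 / (4 * l))) := by
    refine h1.trans (Real.exp_le_exp.2 ?_)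
    have := mul_le_mul_of_nonneg_left (hexp θ (abs_le.2 ⟨by linarith, hθ1⟩)) hl.le
    rw [e, hxθ]
    nlinarith
  have b2 : (poissonMeasure l.toNNReal).real {k | (k : ℝ) ≤ l - x} ≤
      Real.exp (-(x ^ 2 / (4 * l))) := by
    refine h2.trans (Real.exp_le_exp.2 ?_)
    have := mul_le_mul_of_nonneg_left (hexp (-θ) (abs_le.2 ⟨by linarith, by linarith⟩)) hl.le
    rw [e, hxθ]
    nlinarith
  have hsub : {k : ℕ | x ≤ |(k : ℝ) - l|} ⊆ {k | l + x ≤ (k : ℝ)} ∪ {k | (k : ℝ) ≤ l - x} := by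
    intro k hk
    rcases le_abs.1 (show x ≤ |(k : ℝ) - l| from hk) with h | h
    · exact Or.inl (show l + x ≤ (k : ℝ) by linarith)
    · exact Or.inr (show (k : ℝ) ≤ l - x by linarith)
  calc _ ≤ _ := measureReal_mono hsub
    _ ≤ _ := measureReal_union_le _ _
    _ ≤ _ := by linarith

/-- The expression is the logarithm of the characteristic function of `(Po(l) - l) / √V`. The
quadratic Taylor term gives `-u² l / (2V)`, and the cubic remainder is at most `l |u / √V|³ = u² (l
/ V) |u / √V|`, which tends to zero. -/
theorem tendsto_mul_exp_mul_I_sub {l V : ℕ → ℝ} (hl : Tendsto l atTop atTop)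
    (hV : Tendsto (fun n => V n / l n) atTop (𝓝 1)) (u : ℝ) :
    Tendsto (fun n => (l n : ℂ) * (Complex.exp ((u / √(V n) : ℝ) * Complex.I) - 1 -
      (u / √(V n) : ℝ) * Complex.I)) atTop (𝓝 (-u ^ 2 / 2)) := by
  have hVtop : Tendsto V atTop atTop := by
    refine (Tendsto.pos_mul_atTop one_pos hV hl).congr' ?_
    filter_upwards [hl.eventually_gt_atTop 0] with n hn
    field_simp
  have hinv : Tendsto (fun n => l n / V n) atTop (𝓝 1) := by
    simpa using hV.inv₀ one_ne_zero
  have hv : Tendsto (fun n => u / √(V n)) atTop (𝓝 0) :=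
    tendsto_const_nhds.div_atTop (Real.tendsto_sqrt_atTop.comp hVtop)
  have hmain : Tendsto (fun n => ((-(u ^ 2) / 2 * (l n / V n) : ℝ) : ℂ)) atTop
      (𝓝 (-u ^ 2 / 2)) := by
    have := (Complex.continuous_ofReal.tendsto _).comp (hinv.const_mul (-(u ^ 2) / 2))
    simpa [Function.comp_def] using this
  have hrem : Tendsto (fun n => (l n : ℂ) * (Complex.exp ((u / √(V n) : ℝ) * Complex.I) - 1 -
      (u / √(V n) : ℝ) * Complex.I) - ((-(u ^ 2) / 2 * (l n / V n) : ℝ) : ℂ)) atTop (𝓝 0) := by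
    have hb : Tendsto (fun n => u ^ 2 * (l n / V n) * |u / √(V n)|) atTop (𝓝 0) := by
      simpa using (hinv.const_mul (u ^ 2)).mul hv.abs
    refine squeeze_zero_norm' ?_ hb
    filter_upwards [hl.eventually_gt_atTop 0, hVtop.eventually_gt_atTop 0,
      hv.abs.eventually_le_const (show |(0 : ℝ)| < 1 by simp)] with n hn hVn hvn
    have hbound := Complex.exp_bound (x := (u / √(V n) : ℝ) * Complex.I) (n := 3)
      (by rwa [norm_mul, Complex.norm_I, mul_one, Complex.norm_real]) (by norm_num)
    have hsq : (u / √(V n)) ^ 2 = u ^ 2 / V n := by rw [div_pow, Real.sq_sqrt hVn.le]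
    have e : (l n : ℂ) * (Complex.exp ((u / √(V n) : ℝ) * Complex.I) - 1 -
        (u / √(V n) : ℝ) * Complex.I) - ((-(u ^ 2) / 2 * (l n / V n) : ℝ) : ℂ) =
        (l n : ℂ) * (Complex.exp ((u / √(V n) : ℝ) * Complex.I) -
          ∑ m ∈ Finset.range 3, ((u / √(V n) : ℝ) * Complex.I) ^ m / m.factorial) := by
      have h2 : (-(u ^ 2) / 2 * (l n / V n) : ℝ) = -(l n * (u / √(V n)) ^ 2 / 2) := by
        rw [hsq]; ring
      rw [h2]
      simp only [Finset.sum_range_succ, Finset.sum_range_zero, mul_pow, Complex.I_sq]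
      push_cast
      simp [Nat.factorial]
      ring
    rw [e, norm_mul, Complex.norm_real, Real.norm_of_nonneg hn.le]
    calc _ ≤ l n * (|u / √(V n)| ^ 3 * 1) := by
          refine mul_le_mul_of_nonneg_left (hbound.trans ?_) hn.le
          rw [norm_mul, Complex.norm_I, mul_one, Complex.norm_real, Real.norm_eq_abs]
          refine mul_le_mul_of_nonneg_left ?_ (by positivity)
          norm_num [Nat.factorial]
      _ = u ^ 2 * (l n / V n) * |u / √(V n)| := by
          rw [pow_succ, sq_abs, hsq]
          ring
  simpa using hrem.add hmain

/-- Lévy's continuity theorem. The characteristic function of the normalised variable is the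
integral of a unimodular function of the count, so replacing the law of `W n` by the Poisson law
changes it by at most twice the total variation distance. -/
theorem tendstoInDistribution_of_tvDist_poisson {Ω : ℕ → Type*} [∀ n, MeasurableSpace (Ω n)]
    {μ : ∀ n, Measure (Ω n)} [∀ n, IsProbabilityMeasure (μ n)] {W : ∀ n, Ω n → ℕ}
    (hW : ∀ n, Measurable (W n)) {l V : ℕ → ℝ} (hl : Tendsto l atTop atTop)
    (hV : Tendsto (fun n => V n / l n) atTop (𝓝 1))
    (htv : Tendsto (fun n => tvDist ((μ n).map (W n)) (poissonMeasure (l n).toNNReal)) atTop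
      (𝓝 0)) :
    TendstoInDistribution (fun n ω => ((W n ω : ℝ) - l n) / √(V n)) atTop (id : ℝ → ℝ) μ
      (gaussianReal 0 1) where
  forall_aemeasurable n := by
    have := hW n
    fun_prop
  tendsto := by
    refine ProbabilityMeasure.tendsto_iff_tendsto_charFun.2 fun u => ?_
    let g : ∀ n, ℕ → ℂ := fun n k => Complex.exp ((u * (((k : ℝ) - l n) / √(V n)) : ℝ) * Complex.I)
    have hg : ∀ n k, ‖g n k‖ ≤ 1 := fun n k => (Complex.norm_exp_ofReal_mul_I _).le
    have h1 : ∀ n, charFun ((μ n).map fun ω => ((W n ω : ℝ) - l n) / √(V n)) u =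
        ∫ k, g n k ∂((μ n).map (W n)) := fun n => by
      have := hW n
      rw [charFun_apply_real, integral_map (by fun_prop) (by fun_prop),
        integral_map (by fun_prop) (by fun_prop)]
      simp [g]
    have h2 : ∀ᶠ n in atTop, ∫ k, g n k ∂(poissonMeasure (l n).toNNReal) =
        Complex.exp ((l n : ℂ) * (Complex.exp ((u / √(V n) : ℝ) * Complex.I) - 1 -
          (u / √(V n) : ℝ) * Complex.I)) := by
      filter_upwards [hl.eventually_gt_atTop 0] with n hn
      have h := charFun_map_cast_poissonMeasure (l n).toNNReal (u / √(V n))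
      rw [charFun_apply_real, integral_map .of_discrete (by fun_prop),
        Real.coe_toNNReal _ hn.le] at h
      have e : ∀ k : ℕ, g n k = Complex.exp (-(l n * (u / √(V n) : ℝ) * Complex.I)) *
          Complex.exp ((u / √(V n) : ℝ) * ((k : ℝ) : ℂ) * Complex.I) := fun k => by
        rw [← Complex.exp_add]
        dsimp only [g]
        congr 1
        push_cast
        ring
      simp_rw [e]
      rw [integral_const_mul, h, ← Complex.exp_add]
      congr 1
      ring
    have h3 : Tendsto (fun n => ∫ k, g n k ∂(poissonMeasure (l n).toNNReal)) atTop
        (𝓝 (Complex.exp (-u ^ 2 / 2))) :=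
      ((Complex.continuous_exp.tendsto _).comp (tendsto_mul_exp_mul_I_sub hl hV u)).congr'
        (h2.mono fun n hn => hn.symm)
    have h4 : Tendsto (fun n => ∫ k, g n k ∂((μ n).map (W n)) -
        ∫ k, g n k ∂(poissonMeasure (l n).toNNReal)) atTop (𝓝 0) := by
      refine squeeze_zero_norm (fun n => ?_) (by simpa using htv.const_mul 2)
      have := Measure.isProbabilityMeasure_map (μ := μ n) (hW n).aemeasurable
      exact norm_integral_sub_integral_le_tvDist _ _ (hg n)
    have h5 : charFun ((gaussianReal 0 1).map (id : ℝ → ℝ)) u = Complex.exp (-u ^ 2 / 2) := by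
      rw [Measure.map_id, charFun_gaussianReal]
      congr 1
      push_cast
      ring
    simp only [ProbabilityMeasure.coe_mk, h5, h1]
    simpa using h4.add h3

/-! ### Subcube embeddings and canonical copies -/

theorem SimpleGraph.Reachable.eq_of_forall_adj {V β : Type*} {G : SimpleGraph V} {f : V → β}
    (hf : ∀ x y, G.Adj x y → f x = f y) {x y : V} (h : G.Reachable x y) : f x = f y := by
  obtain ⟨p⟩ := h
  induction p with
  | nil => rfl
  | cons hadj _ ih => exact (hf _ _ hadj).trans ih

theorem SimpleGraph.Subgraph.Connected.eq_of_forall_adj {V β : Type*} {G : SimpleGraph V}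
    {H : G.Subgraph} (hH : H.Connected) {f : V → β} (hf : ∀ x y, H.Adj x y → f x = f y) {x y : V}
    (hx : x ∈ H.verts) (hy : y ∈ H.verts) : f x = f y :=
  SimpleGraph.Reachable.eq_of_forall_adj (f := fun v : H.verts => f v)
    (fun _ _ h => hf _ _ h) (hH ⟨x, hx⟩ ⟨y, hy⟩)

theorem SimpleGraph.Subgraph.Connected.map_hom {V W : Type*} {G : SimpleGraph V}
    {G' : SimpleGraph W} {H : G.Subgraph} (hH : H.Connected) (f : G →g G') :
    (H.map f).Connected := by
  refine ⟨hH.coe.map (G := H.coe) (H := (H.map f).coe)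
    ⟨fun x => ⟨f x, x, x.2, rfl⟩, fun {x y} h => ⟨x, y, h, rfl, rfl⟩⟩ ?_⟩
  rintro ⟨_, x, hx, rfl⟩
  exact ⟨⟨x, hx⟩, rfl⟩

theorem hypercube_adj_iff_exists_forall {d : ℕ} {x y : Fin d → Bool} :
    (hypercube d).Adj x y ↔ ∃ i, ∀ k, x k ≠ y k ↔ k = i := by
  change hammingDist x y = 1 ↔ _
  simp [hammingDist, Finset.card_eq_one, Finset.ext_iff]

theorem hypercube_adj_iff_exists_update {d : ℕ} {x y : Fin d → Bool} :
    (hypercube d).Adj x y ↔ ∃ i, y = Function.update x i (!x i) := by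
  rw [hypercube_adj_iff_exists_forall]
  refine exists_congr fun i => ⟨fun h => funext fun k => ?_, ?_⟩
  · by_cases hk : k = i
    · subst hk
      have := (h k).2 rfl
      rw [Function.update_self]
      exact (Bool.not_eq.2 this.symm.symm).symm ▸ rfl
    · rw [Function.update_of_ne hk]
      exact (not_not.1 (mt (h k).1 hk)).symm
  · rintro rfl k
    by_cases hk : k = i
    · subst hk
      simp
    · simp [hk]

/-- The embedding of `Q^s` onto the subcube of `Q^d` with free coordinates `φ` through `b`. -/
noncomputable def cubeEmb {s d : ℕ} (φ : Fin s ↪o Fin d) (b : Fin d → Bool) :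
    hypercube s ↪g hypercube d where
  toFun x := Function.extend φ x b
  inj' x y h := by
    ext j
    rw [← φ.injective.extend_apply x b j, ← φ.injective.extend_apply y b j]
    exact congrArg (· (φ j)) h
  map_rel_iff' {x y} := by
    change hammingDist (Function.extend φ x b) (Function.extend φ y b) = 1 ↔ hammingDist x y = 1
    suffices h : hammingDist (Function.extend φ x b) (Function.extend φ y b) = hammingDist x y by
      rw [h]
    unfold hammingDist
    rw [← Finset.card_map φ.toEmbedding]
    congr 1
    ext k
    simp only [Finset.mem_filter, Finset.mem_univ, true_and, Finset.mem_map,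
      RelEmbedding.coe_toEmbedding]
    constructor
    · intro h
      by_cases hk : ∃ j, φ j = k
      · obtain ⟨j, rfl⟩ := hk
        rw [φ.injective.extend_apply, φ.injective.extend_apply] at h
        exact ⟨j, h, rfl⟩
      · rw [Function.extend_apply' _ _ _ hk, Function.extend_apply' _ _ _ hk] at h
        exact (h rfl).elim
    · rintro ⟨j, h, rfl⟩
      rwa [φ.injective.extend_apply, φ.injective.extend_apply]

section CubeEmb

variable {s d : ℕ} (φ : Fin s ↪o Fin d) (b : Fin d → Bool)

theorem cubeEmb_apply_emb (x : Fin s → Bool) (j : Fin s) : cubeEmb φ b x (φ j) = x j :=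
  φ.injective.extend_apply _ _ _

theorem cubeEmb_apply_of_notMem (x : Fin s → Bool) {k : Fin d} (hk : k ∉ Set.range φ) :
    cubeEmb φ b x k = b k :=
  Function.extend_apply' _ _ _ hk

theorem cubeEmb_comp_self (x : Fin d → Bool) : cubeEmb φ x (fun j => x (φ j)) = x := by
  ext k
  by_cases hk : k ∈ Set.range φ
  · obtain ⟨j, rfl⟩ := hk
    rw [cubeEmb_apply_emb]
  · rw [cubeEmb_apply_of_notMem _ _ _ hk]

variable {φ b} in
theorem cubeEmb_congr {b' : Fin d → Bool} (h : ∀ k ∉ Set.range φ, b k = b' k) :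
    cubeEmb φ b = cubeEmb φ b' := by
  ext x k
  by_cases hk : k ∈ Set.range φ
  · obtain ⟨j, rfl⟩ := hk
    rw [cubeEmb_apply_emb, cubeEmb_apply_emb]
  · rw [cubeEmb_apply_of_notMem _ _ _ hk, cubeEmb_apply_of_notMem _ _ _ hk, h k hk]

end CubeEmb

namespace CubeSubgraph

section Map

variable {s d : ℕ} (K : (hypercube s).Subgraph) (f : hypercube s ↪g hypercube d)

theorem size_map : size ⟨d, K.map f.toHom⟩ = size ⟨s, K⟩ :=
  Set.ncard_image_of_injective _ f.injective

theorem numEdges_map : numEdges ⟨d, K.map f.toHom⟩ = numEdges ⟨s, K⟩ := by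
  rw [numEdges, numEdges]
  simp only [SimpleGraph.Subgraph.edgeSet_map]
  exact Set.ncard_image_of_injective _ (Sym2.map.injective f.injective)

theorem numMissingEdges_map : numMissingEdges ⟨d, K.map f.toHom⟩ = numMissingEdges ⟨s, K⟩ := by
  rw [numMissingEdges, numMissingEdges, ← Set.ncard_image_of_injective _
    (Sym2.map.injective f.injective)]
  congr 1
  ext e
  simp only [SimpleGraph.Subgraph.edgeSet_map, Set.mem_ofPred_eq, Set.mem_image]
  constructor
  · rintro ⟨he, hne, hv⟩
    induction e with | _ x y => ?_
    obtain ⟨x, hx, rfl⟩ := hv x (by simp)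
    obtain ⟨y, hy, rfl⟩ := hv y (by simp)
    refine ⟨s(x, y), ⟨f.map_adj_iff.1 he, fun h => hne ⟨_, h, rfl⟩, ?_⟩, rfl⟩
    intro v hv
    rcases Sym2.mem_iff.1 hv with rfl | rfl <;> assumption
  · rintro ⟨e, ⟨he, hne, hv⟩, rfl⟩
    induction e with | _ x y => ?_
    refine ⟨f.map_adj_iff.2 he, ?_, ?_⟩
    · rintro ⟨e', he', h⟩
      exact hne (Sym2.map.injective f.injective h ▸ he')
    · intro v hv'
      rcases Sym2.mem_iff.1 hv' with rfl | rfl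
      · exact ⟨x, hv x (by simp), rfl⟩
      · exact ⟨y, hv y (by simp), rfl⟩

end Map

variable (H : CubeSubgraph)

theorem mem_dirSupport {H : CubeSubgraph} {k : Fin H.1} :
    k ∈ H.dirSupport ↔ ∃ x y, H.2.Adj x y ∧ x k = false ∧ y k = true := by
  simp [dirSupport]

theorem mem_dirSupport_of_adj {H : CubeSubgraph} {x y : Fin H.1 → Bool} (h : H.2.Adj x y)
    {k : Fin H.1} (hk : x k ≠ y k) : k ∈ H.dirSupport := by
  rw [mem_dirSupport]
  cases hx : x k <;> cases hy : y k
  · simp [hx, hy] at hk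
  · exact ⟨x, y, h, hx, hy⟩
  · exact ⟨y, x, h.symm, hy, hx⟩
  · simp [hx, hy] at hk

theorem range_coordEmb : Set.range H.coordEmb = H.dirSupport :=
  Finset.range_orderEmbOfFin _ _

variable {H}

theorem apply_eq_of_notMem_dirSupport (hH : H.2.Connected) {x y : Fin H.1 → Bool}
    (hx : x ∈ H.2.verts) (hy : y ∈ H.2.verts) {k : Fin H.1} (hk : k ∉ H.dirSupport) :
    x k = y k :=
  hH.eq_of_forall_adj (f := fun z => z k)
    (fun _ _ h => not_not.1 fun hne => hk (mem_dirSupport_of_adj h hne)) hx hy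

theorem cubeEmb_restrict (hH : H.2.Connected) {b x : Fin H.1 → Bool} (hb : b ∈ H.2.verts)
    (hx : x ∈ H.2.verts) : cubeEmb H.coordEmb b (H.restrict x) = x := by
  conv_rhs => rw [← cubeEmb_comp_self H.coordEmb x]
  rw [cubeEmb_congr (b' := x)]
  · rfl
  · intro k hk
    rw [range_coordEmb] at hk
    exact apply_eq_of_notMem_dirSupport hH hb hx hk

/-- Coordinates outside the support are constant on a connected `H`, so any vertex `b` of `H`
supplies their values. -/
theorem map_canonicalCopy (hH : H.2.Connected) {b : Fin H.1 → Bool} (hb : b ∈ H.2.verts) :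
    H.canonicalCopy.2.map (cubeEmb H.coordEmb b).toHom = H.2 := by
  ext u v
  · constructor
    · rintro ⟨_, ⟨x, hx, rfl⟩, rfl⟩
      exact (cubeEmb_restrict hH hb hx).symm ▸ hx
    · intro hu
      exact ⟨_, ⟨u, hu, rfl⟩, cubeEmb_restrict hH hb hu⟩
  · constructor
    · rintro ⟨_, _, ⟨x, y, h, rfl, rfl⟩, rfl, rfl⟩
      have hx := cubeEmb_restrict hH hb (H.2.edge_vert h)
      have hy := cubeEmb_restrict hH hb (H.2.edge_vert h.symm)
      change H.2.Adj (cubeEmb H.coordEmb b (H.restrict x)) (cubeEmb H.coordEmb b (H.restrict y))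
      rwa [hx, hy]
    · intro h
      exact ⟨_, _, ⟨u, v, h, rfl, rfl⟩, cubeEmb_restrict hH hb (H.2.edge_vert h),
        cubeEmb_restrict hH hb (H.2.edge_vert h.symm)⟩

theorem canonicalCopy_connected (hH : H.2.Connected) : H.canonicalCopy.2.Connected := by
  refine ⟨hH.coe.map (G := H.2.coe) (H := H.canonicalCopy.2.coe)
    ⟨fun x => ⟨H.restrict x, x, x.2, rfl⟩, fun {x y} h => ⟨x, y, h, rfl, rfl⟩⟩ ?_⟩
  rintro ⟨_, x, hx, rfl⟩
  exact ⟨⟨x, hx⟩, rfl⟩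

theorem exists_canonicalCopy_adj (H : CubeSubgraph) (j : Fin H.span) :
    ∃ x y, H.canonicalCopy.2.Adj x y ∧ x j = false ∧ y j = true := by
  have hj : H.coordEmb j ∈ H.dirSupport := by
    rw [← Finset.mem_coe, ← range_coordEmb]
    exact ⟨j, rfl⟩
  obtain ⟨x, y, h, hx, hy⟩ := mem_dirSupport.1 hj
  exact ⟨_, _, ⟨x, y, h, rfl, rfl⟩, hx, hy⟩

/-- An increasing injection with prescribed image is unique, so `φ` must be the one used in the
canonical copy. -/
theorem canonicalCopy_eq_of {s : ℕ} (φ : Fin s ↪o Fin H.1) (hφ : Set.range φ = H.dirSupport)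
    (K : (hypercube s).Subgraph) (hv : K.verts = (fun x j => x (φ j)) '' H.2.verts)
    (hadj : ∀ u v, K.Adj u v ↔ ∃ x y, H.2.Adj x y ∧ (fun j => x (φ j)) = u ∧
      (fun j => y (φ j)) = v) : H.canonicalCopy = ⟨s, K⟩ := by
  have hs : s = H.span := by
    rw [← card_dirSupport, ← Set.ncard_coe_finset, ← hφ, Set.ncard_range_of_injective φ.injective,
      Nat.card_fin]
  subst hs
  have hφ' : φ = H.coordEmb := Finset.orderEmbOfFin_unique' H.card_dirSupport fun j => by
    rw [← Finset.mem_coe, ← hφ]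
    exact ⟨j, rfl⟩
  subst hφ'
  refine congrArg (Sigma.mk H.span) (SimpleGraph.Subgraph.ext hv.symm ?_)
  ext u v
  exact (hadj u v).symm

theorem dirSupport_map_cubeEmb {s d : ℕ} (K : (hypercube s).Subgraph) (φ : Fin s ↪o Fin d)
    (b : Fin d → Bool) (hK : ∀ j, ∃ x y, K.Adj x y ∧ x j = false ∧ y j = true) :
    ((dirSupport ⟨d, K.map (cubeEmb φ b).toHom⟩ : Finset (Fin d)) : Set (Fin d)) =
      Set.range φ := by
  ext k
  rw [Finset.mem_coe, mem_dirSupport]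
  constructor
  · rintro ⟨_, _, ⟨x, y, -, rfl, rfl⟩, h0, h1⟩
    by_contra hk
    have e0 := cubeEmb_apply_of_notMem φ b x hk
    have e1 := cubeEmb_apply_of_notMem φ b y hk
    change cubeEmb φ b x k = false at h0
    change cubeEmb φ b y k = true at h1
    rw [← e1, h1, h0] at e0
    cases e0
  · rintro ⟨j, rfl⟩
    obtain ⟨x, y, h, h0, h1⟩ := hK j
    exact ⟨_, _, ⟨x, y, h, rfl, rfl⟩, (cubeEmb_apply_emb φ b x j).trans h0,
      (cubeEmb_apply_emb φ b y j).trans h1⟩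

/-- By `hK` every direction of `Q^s` is used by an edge of `K`, so the support of the image is the
whole range of `φ` and no coordinate is lost. -/
theorem canonicalCopy_map_cubeEmb {s d : ℕ} (K : (hypercube s).Subgraph) (φ : Fin s ↪o Fin d)
    (b : Fin d → Bool) (hK : ∀ j, ∃ x y, K.Adj x y ∧ x j = false ∧ y j = true) :
    canonicalCopy ⟨d, K.map (cubeEmb φ b).toHom⟩ = ⟨s, K⟩ := by
  have key : ∀ x, (fun j => cubeEmb φ b x (φ j)) = x := fun x =>
    funext fun j => cubeEmb_apply_emb φ b x j
  refine canonicalCopy_eq_of (H := ⟨d, K.map (cubeEmb φ b).toHom⟩) φ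
    (dirSupport_map_cubeEmb K φ b hK).symm K ?_ fun u v => ⟨fun h => ?_, ?_⟩
  · ext x
    constructor
    · exact fun hx => ⟨_, ⟨x, hx, rfl⟩, key x⟩
    · rintro ⟨_, ⟨y, hy, rfl⟩, rfl⟩
      change (fun j => cubeEmb φ b y (φ j)) ∈ K.verts
      rwa [key]
  · exact ⟨_, _, ⟨u, v, h, rfl, rfl⟩, key u, key v⟩
  · rintro ⟨_, _, ⟨x, y, h, rfl, rfl⟩, rfl, rfl⟩
    change K.Adj (fun j => cubeEmb φ b x (φ j)) (fun j => cubeEmb φ b y (φ j))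
    rwa [key, key]

theorem exists_eq_map_cubeEmb {d : ℕ} {G : (hypercube d).Subgraph} (hG : G.Connected)
    {b : Fin d → Bool} (hb : b ∈ G.verts) {C : CubeSubgraph}
    (h : canonicalCopy ⟨d, G⟩ = C) :
    ∃ φ : Fin C.1 ↪o Fin d, G = C.2.map (cubeEmb φ b).toHom := by
  subst h
  exact ⟨coordEmb ⟨d, G⟩, (map_canonicalCopy (H := ⟨d, G⟩) hG hb).symm⟩

theorem size_canonicalCopy (hH : H.2.Connected) : H.canonicalCopy.size = H.size := by
  obtain ⟨b, hb⟩ := hH.nonempty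
  have := size_map (s := H.span) H.canonicalCopy.2 (cubeEmb H.coordEmb b)
  erw [map_canonicalCopy hH hb] at this
  exact this.symm

theorem numEdges_canonicalCopy (hH : H.2.Connected) : H.canonicalCopy.numEdges = H.numEdges := by
  obtain ⟨b, hb⟩ := hH.nonempty
  have := numEdges_map (s := H.span) H.canonicalCopy.2 (cubeEmb H.coordEmb b)
  erw [map_canonicalCopy hH hb] at this
  exact this.symm

theorem numMissingEdges_canonicalCopy (hH : H.2.Connected) :
    H.canonicalCopy.numMissingEdges = H.numMissingEdges := by
  obtain ⟨b, hb⟩ := hH.nonempty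
  have := numMissingEdges_map (s := H.span) H.canonicalCopy.2 (cubeEmb H.coordEmb b)
  erw [map_canonicalCopy hH hb] at this
  exact this.symm

end CubeSubgraph

/-! ### Span versus size, and the number of copies of a cube subgraph -/

namespace CubeSubgraph

variable {H : CubeSubgraph}

/-- A spanning tree has an edge in every direction of the support, since otherwise that coordinate
would be constant on `H`. Different directions give different edges, and a tree has one edge fewer
than vertices. -/
theorem span_lt_size (hH : H.2.Connected) : H.span < H.size := by
  classical
  obtain ⟨T, hT, hTree⟩ := hH.coe.exists_isTree_le
  have hex : ∀ k : H.dirSupport, ∃ x y : H.2.verts, T.Adj x y ∧ x.1 k ≠ y.1 k := by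
    rintro ⟨k, hk⟩
    by_contra hcon
    push Not at hcon
    obtain ⟨x, y, hxy, hx, hy⟩ := mem_dirSupport.1 hk
    have := (hTree.connected ⟨x, H.2.edge_vert hxy⟩
      ⟨y, H.2.edge_vert hxy.symm⟩).eq_of_forall_adj (f := fun z => z.1 k) hcon
    exact Bool.false_ne_true (hx.symm.trans (this.trans hy))
  choose x y hadj hne using hex
  have : Fintype H.2.verts := Fintype.ofFinite _
  have hinj : Function.Injective fun k => (⟨s(x k, y k), hadj k⟩ : T.edgeSet) := by
    intro k l h
    have h' : s(x k, y k) = s(x l, y l) := congrArg Subtype.val h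
    have hcube : (hypercube H.1).Adj (x k).1 (y k).1 := H.2.adj_sub (hT (hadj k))
    obtain ⟨i, hi⟩ := hypercube_adj_iff_exists_forall.1 hcube
    have hk := (hi k).1 (hne k)
    have hl : (l : Fin H.1) = i := by
      refine (hi l).1 ?_
      rcases Sym2.eq_iff.1 h' with ⟨h1, h2⟩ | ⟨h1, h2⟩
      · rw [h1, h2]; exact hne l
      · rw [h1, h2]; exact (hne l).symm
    exact Subtype.ext (hk.trans hl.symm)
  have h1 := Fintype.card_le_of_injective _ hinj
  rw [Fintype.card_coe, ← SimpleGraph.edgeFinset_card] at h1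
  have h2 := hTree.card_edgeFinset
  have h3 : H.size = Fintype.card H.2.verts := by
    rw [size, ← Nat.card_coe_set_eq, Nat.card_eq_fintype_card]
  rw [← card_dirSupport]
  omega

theorem size_le_two_pow_span (hH : H.2.Connected) : H.size ≤ 2 ^ H.span := by
  rw [← size_canonicalCopy hH]
  refine (Set.ncard_le_card _).trans ?_
  simp [canonicalCopy]

theorem one_le_size (hH : H.2.Connected) : 1 ≤ H.size := by
  have := span_lt_size hH
  omega

end CubeSubgraph

open CubeSubgraph

/-- The connected subgraphs of `Q^d` which are ambient-isomorphic to `H`. -/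
abbrev CubeCopy (d : ℕ) (H : CubeSubgraph) : Type :=
  {G : (hypercube d).Subgraph // G.Connected ∧ AmbientIso ⟨d, G⟩ H}

namespace CubeCopy

variable {d : ℕ} {H : CubeSubgraph}

/-- The copy of `H` in the subcube with free coordinates `φ` through `b`. -/
noncomputable def ofEmb (hH : H.2.Connected) (φ : Fin H.span ↪o Fin d) (b : Fin d → Bool) :
    CubeCopy d H :=
  ⟨H.canonicalCopy.2.map (cubeEmb φ b).toHom, (canonicalCopy_connected hH).map_hom _,
    canonicalCopy_map_cubeEmb (s := H.span) H.canonicalCopy.2 φ b H.exists_canonicalCopy_adj⟩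

theorem exists_eq_ofEmb (hH : H.2.Connected) (G : CubeCopy d H) {b : Fin d → Bool}
    (hb : b ∈ G.1.verts) : ∃ φ, G = ofEmb hH φ b := by
  obtain ⟨φ, h⟩ := exists_eq_map_cubeEmb G.2.1 hb G.2.2
  exact ⟨φ, Subtype.ext h⟩

theorem range_eq_of_ofEmb_eq (hH : H.2.Connected) {φ φ' : Fin H.span ↪o Fin d}
    {b b' : Fin d → Bool} (h : ofEmb hH φ b = ofEmb hH φ' b') : Set.range φ = Set.range φ' := by
  rw [← dirSupport_map_cubeEmb (s := H.span) H.canonicalCopy.2 φ b H.exists_canonicalCopy_adj,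
    ← dirSupport_map_cubeEmb (s := H.span) H.canonicalCopy.2 φ' b' H.exists_canonicalCopy_adj]
  have h' := congrArg (fun G : CubeCopy d H =>
    ((dirSupport ⟨d, G.1⟩ : Finset (Fin d)) : Set (Fin d))) h
  exact h'

theorem apply_eq_of_ofEmb_eq (hH : H.2.Connected) {φ : Fin H.span ↪o Fin d}
    {b b' : Fin d → Bool} (h : ofEmb hH φ b = ofEmb hH φ b') {k : Fin d}
    (hk : k ∉ Set.range φ) : b k = b' k := by
  obtain ⟨x, hx⟩ := (canonicalCopy_connected hH).nonempty
  have hmem : cubeEmb φ b x ∈ (ofEmb hH φ b).1.verts := ⟨x, hx, rfl⟩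
  rw [h] at hmem
  obtain ⟨y, -, hy⟩ := hmem
  exact (cubeEmb_apply_of_notMem φ b x hk).symm.trans
    ((congrFun hy k).symm.trans (cubeEmb_apply_of_notMem φ b' y hk))

/-- A copy amounts to a set of free directions and a value for each fixed coordinate. There is no
symmetry factor, because ambient isomorphism allows neither permutations nor reflections of the free
directions. -/
theorem card_eq (hH : H.2.Connected) :
    Nat.card (CubeCopy d H) = d.choose H.span * 2 ^ (d - H.span) := by
  classical
  let F : (Σ S : {S : Finset (Fin d) // S.card = H.span}, ({k // k ∉ S.1} → Bool)) →
      CubeCopy d H := fun x => ofEmb hH (x.1.1.orderEmbOfFin x.1.2)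
        fun k => if h : k ∈ x.1.1 then false else x.2 ⟨k, h⟩
  have hF : Function.Bijective F := by
    constructor
    · rintro ⟨⟨S, hS⟩, c⟩ ⟨⟨S', hS'⟩, c'⟩ h
      have hr := range_eq_of_ofEmb_eq hH h
      dsimp only at hr
      rw [Finset.range_orderEmbOfFin, Finset.range_orderEmbOfFin, Finset.coe_inj] at hr
      subst hr
      congr 1
      funext k
      have := apply_eq_of_ofEmb_eq hH h (k := k.1)
        (by rw [Finset.range_orderEmbOfFin]; exact k.2)
      simpa [k.2] using this
    · intro G
      obtain ⟨b, hb⟩ := G.2.1.nonempty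
      obtain ⟨φ, rfl⟩ := exists_eq_ofEmb hH G hb
      have hS : (Finset.univ.map φ.toEmbedding).card = H.span := by simp
      refine ⟨⟨⟨Finset.univ.map φ.toEmbedding, hS⟩, fun k => b k⟩, ?_⟩
      have hφ : φ = (Finset.univ.map φ.toEmbedding).orderEmbOfFin hS :=
        Finset.orderEmbOfFin_unique' hS fun j => by simp
      refine Subtype.ext ?_
      dsimp only [F, ofEmb]
      rw [← hφ, cubeEmb_congr]
      intro k hk
      have : k ∉ Finset.univ.map φ.toEmbedding := by simpa using hk
      rw [dif_neg this]
  rw [← Nat.card_eq_of_bijective F hF, Nat.card_eq_fintype_card, Fintype.card_sigma]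
  have h2 : ∀ S : {S : Finset (Fin d) // S.card = H.span},
      Fintype.card ({k // k ∉ S.1} → Bool) = 2 ^ (d - H.span) := by
    rintro ⟨S, hS⟩
    rw [Fintype.card_fun, Fintype.card_bool, Fintype.card_subtype_compl, Fintype.card_fin,
      Fintype.card_coe, hS]
  rw [Finset.sum_congr rfl fun S _ => h2 S, Finset.sum_const, Finset.card_univ,
    Fintype.card_finset_len, Fintype.card_fin, smul_eq_mul]

/-- The vertex `x` determines the fixed coordinates, so only the choice of free directions remains.
-/
theorem card_through_le (hH : H.2.Connected) (x : Fin d → Bool) :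
    Nat.card {G : CubeCopy d H // x ∈ G.1.verts} ≤ d ^ H.span := by
  have hex : ∀ G : {G : CubeCopy d H // x ∈ G.1.verts}, ∃ φ, G.1 = ofEmb hH φ x :=
    fun G => exists_eq_ofEmb hH G.1 G.2
  choose φ hφ using hex
  have hinj : Function.Injective fun G => (φ G : Fin H.span → Fin d) := by
    intro G G' h
    have h' : φ G = φ G' := DFunLike.coe_injective h
    exact Subtype.ext ((hφ G).trans (h' ▸ (hφ G').symm))
  simpa using Nat.card_le_card_of_injective _ hinj

theorem size_eq (hH : H.2.Connected) (G : CubeCopy d H) : size ⟨d, G.1⟩ = H.size := by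
  have h : canonicalCopy ⟨d, G.1⟩ = H.canonicalCopy := G.2.2
  rw [← size_canonicalCopy hH, ← h, size_canonicalCopy (H := ⟨d, G.1⟩) G.2.1]

theorem numEdges_eq (hH : H.2.Connected) (G : CubeCopy d H) :
    numEdges ⟨d, G.1⟩ = H.numEdges := by
  have h : canonicalCopy ⟨d, G.1⟩ = H.canonicalCopy := G.2.2
  rw [← numEdges_canonicalCopy hH, ← h, numEdges_canonicalCopy (H := ⟨d, G.1⟩) G.2.1]

theorem numMissingEdges_eq (hH : H.2.Connected) (G : CubeCopy d H) :
    numMissingEdges ⟨d, G.1⟩ = H.numMissingEdges := by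
  have h : canonicalCopy ⟨d, G.1⟩ = H.canonicalCopy := G.2.2
  rw [← numMissingEdges_canonicalCopy hH, ← h,
    numMissingEdges_canonicalCopy (H := ⟨d, G.1⟩) G.2.1]

end CubeCopy

/-! ### Components of the open graph as cylinder events -/

noncomputable instance CubeCopy.fintype (d : ℕ) (H : CubeSubgraph) : Fintype (CubeCopy d H) :=
  Fintype.ofFinite _

section Event

variable {d : ℕ}

open Classical in
/-- The edges of the cube with at least one end vertex in `G`. -/
noncomputable def touchingEdges (G : (hypercube d).Subgraph) : Finset (hypercube d).edgeSet :=
  {e | ∃ v ∈ e.1, v ∈ G.verts}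

open Classical in
/-- The indicator of the edges of `G`. -/
noncomputable def edgeStatus (G : (hypercube d).Subgraph) (e : (hypercube d).edgeSet) : Bool :=
  decide (e.1 ∈ G.edgeSet)

/-- For connected `G`, the event that `G` is a component of the open graph. -/
def compEvent (G : (hypercube d).Subgraph) : Set (EdgeConfig d) :=
  {ω | ∀ e ∈ touchingEdges G, ω e = edgeStatus G e}

variable {G G' : (hypercube d).Subgraph} {ω : EdgeConfig d}

theorem mem_touchingEdges {e : (hypercube d).edgeSet} :
    e ∈ touchingEdges G ↔ ∃ v ∈ e.1, v ∈ G.verts := by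
  simp [touchingEdges]

theorem mem_compEvent_iff :
    ω ∈ compEvent G ↔ ∀ x ∈ G.verts, ∀ y, (openGraph ω).Adj x y ↔ G.Adj x y := by
  constructor
  · intro h x hx y
    constructor
    · rintro ⟨hxy, hω⟩
      rw [h ⟨s(x, y), hxy⟩ (mem_touchingEdges.2 ⟨x, by simp, hx⟩)] at hω
      simpa [edgeStatus] using hω
    · intro hxy
      refine ⟨G.adj_sub hxy, ?_⟩
      rw [h ⟨s(x, y), G.adj_sub hxy⟩ (mem_touchingEdges.2 ⟨x, by simp, hx⟩)]
      simpa [edgeStatus] using hxy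
  · rintro h ⟨e, he⟩ hT
    obtain ⟨x, hxe, hx⟩ := mem_touchingEdges.1 hT
    obtain ⟨y, rfl⟩ := Sym2.mem_iff_exists.1 hxe
    have := h x hx y
    rw [Bool.eq_iff_iff]
    simp only [edgeStatus, decide_eq_true_eq, SimpleGraph.Subgraph.mem_edgeSet]
    rw [← this]
    exact ⟨fun hω => ⟨he, hω⟩, fun ⟨_, hω⟩ => hω⟩

/-- On both events, an edge of `G` at a vertex of `G'` is open and so belongs to `G'`; membership in
`G'` thus spreads from `v` over the connected graph `G`. -/
theorem le_of_mem_compEvent (hG : G.Connected) (h : ω ∈ compEvent G) (h' : ω ∈ compEvent G')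
    {v : Fin d → Bool} (hv : v ∈ G.verts) (hv' : v ∈ G'.verts) : G ≤ G' := by
  rw [mem_compEvent_iff] at h h'
  have hsub : G.verts ⊆ G'.verts := by
    intro x hx
    have := hG.eq_of_forall_adj (f := fun z => z ∈ G'.verts) (fun a b hab => by
      have h1 : ∀ {a b}, G.Adj a b → a ∈ G'.verts → b ∈ G'.verts := fun {a b} hab ha =>
        G'.edge_vert ((h' a ha b).1 ((h a (G.edge_vert hab) b).2 hab)).symm
      exact propext ⟨h1 hab, h1 hab.symm⟩) hv hx
    exact this.mp hv'
  exact ⟨hsub, fun a b hab =>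
    (h' a (hsub (G.edge_vert hab)) b).1 ((h a (G.edge_vert hab) b).2 hab)⟩

theorem disjoint_compEvent (hG : G.Connected) (hG' : G'.Connected) (hne : G ≠ G')
    (hV : ¬ Disjoint G.verts G'.verts) : Disjoint (compEvent G) (compEvent G') := by
  rw [Set.not_disjoint_iff] at hV
  obtain ⟨v, hv, hv'⟩ := hV
  exact Set.disjoint_left.2 fun ω h h' => hne <|
    le_antisymm (le_of_mem_compEvent hG h h' hv hv') (le_of_mem_compEvent hG' h' h hv' hv)

theorem componentSubgraph_connected (ω : EdgeConfig d) (C : (openGraph ω).ConnectedComponent) :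
    (componentSubgraph ω C).2.Connected := by
  refine ⟨C.connected_toSimpleGraph.map (H := (componentSubgraph ω C).2.coe)
    ⟨fun x => x, fun {x y} h => ⟨h, x.2⟩⟩ ?_⟩
  exact fun x => ⟨x, rfl⟩

theorem mem_compEvent_componentSubgraph (ω : EdgeConfig d)
    (C : (openGraph ω).ConnectedComponent) : ω ∈ compEvent (componentSubgraph ω C).2 :=
  mem_compEvent_iff.2 fun _ hx _ => ⟨fun h => ⟨h, hx⟩, fun h => h.1⟩

/-- On this event `G` is a connected subgraph of the open graph that no open edge leaves. -/
theorem exists_componentSubgraph_eq (hG : G.Connected) (h : ω ∈ compEvent G) :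
    ∃ C, componentSubgraph ω C = ⟨d, G⟩ := by
  rw [mem_compEvent_iff] at h
  let G₁ : (openGraph ω).Subgraph :=
    { verts := G.verts
      Adj := G.Adj
      adj_sub := fun {a b} hab => (h a (G.edge_vert hab) b).2 hab
      edge_vert := G.edge_vert
      symm := G.symm }
  have hG₁ : G₁.Connected := ⟨hG.coe⟩
  obtain ⟨C, hC⟩ := hG₁.exists_verts_eq_connectedComponentSupp fun v hv w hvw => (h v hv w).1 hvw
  have hC' : G.verts = C.supp := hC
  refine ⟨C, congrArg (Sigma.mk d) (SimpleGraph.Subgraph.ext hC'.symm ?_)⟩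
  ext x y
  change (openGraph ω).Adj x y ∧ x ∈ C.supp ↔ _
  rw [← hC']
  exact ⟨fun hxy => (h x hxy.2 y).1 hxy.1,
    fun hxy => ⟨(h x (G.edge_vert hxy) y).2 hxy, G.edge_vert hxy⟩⟩

theorem componentSubgraph_injective (ω : EdgeConfig d) :
    Function.Injective (componentSubgraph ω) := by
  intro C C' h
  have h' := eq_of_heq (Sigma.mk.inj h).2
  exact SimpleGraph.ConnectedComponent.supp_injective (congrArg SimpleGraph.Subgraph.verts h')

open Classical in
/-- The indicator of `compEvent`. -/
noncomputable def compIndicator (G : (hypercube d).Subgraph) (ω : EdgeConfig d) : ℕ :=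
  if ω ∈ compEvent G then 1 else 0

theorem compIndicator_le_one (G : (hypercube d).Subgraph) (ω : EdgeConfig d) :
    compIndicator G ω ≤ 1 := by
  unfold compIndicator
  split_ifs <;> simp

theorem componentCount_eq_sum (H : CubeSubgraph) (ω : EdgeConfig d) :
    componentCount H ω = ∑ G : CubeCopy d H, compIndicator G.1 ω := by
  classical
  simp only [compIndicator]
  rw [Finset.sum_boole, Nat.cast_id, ← Fintype.card_subtype, ← Nat.card_eq_fintype_card,
    componentCount]
  refine Nat.card_eq_of_bijective (fun C => ⟨⟨(componentSubgraph ω C.1).2,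
    componentSubgraph_connected ω C.1, C.2⟩, mem_compEvent_componentSubgraph ω C.1⟩) ⟨?_, ?_⟩
  · intro C C' h
    refine Subtype.ext (componentSubgraph_injective ω ?_)
    have h' : (componentSubgraph ω C.1).2 = (componentSubgraph ω C'.1).2 :=
      congrArg (fun G => G.1.1) h
    exact congrArg (Sigma.mk d) h'
  · rintro ⟨⟨G, hG, hiso⟩, hω⟩
    obtain ⟨C, hC⟩ := exists_componentSubgraph_eq hG hω
    refine ⟨⟨C, by rw [hC]; exact hiso⟩, ?_⟩
    refine Subtype.ext (Subtype.ext ?_)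
    exact eq_of_heq (Sigma.mk.inj hC).2

end Event

/-! ### Probabilities of cylinder events -/

section Probability

variable (p : unitInterval) {d : ℕ}

/-- The probability that an edge is open, respectively closed. -/
noncomputable def edgeWeight (b : Bool) : ℝ := if b then p else 1 - p

theorem edgeMeasure_real_cylinder (T : Finset (hypercube d).edgeSet) (b : EdgeConfig d) :
    (edgeMeasure p d).real {ω | ∀ e ∈ T, ω e = b e} = ∏ e ∈ T, edgeWeight p (b e) := by
  classical
  have h : {ω : EdgeConfig d | ∀ e ∈ T, ω e = b e} =
      Set.univ.pi fun e => if e ∈ T then {b e} else Set.univ := by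
    ext ω
    simp only [Set.mem_ofPred_eq, Set.mem_univ_pi]
    refine forall_congr' fun e => ?_
    split_ifs with he <;> simp [he]
  rw [h, measureReal_def, edgeMeasure, Measure.pi_pi, ENNReal.toReal_prod,
    ← Finset.prod_subset (Finset.subset_univ T)]
  · refine Finset.prod_congr rfl fun e he => ?_
    rw [if_pos he, ← measureReal_def, bernoulliMeasure_real_apply _ (MeasurableSet.singleton _)]
    cases b e <;> simp [edgeWeight]
  · intro e _ he
    simp [he]

theorem integral_compIndicator (G : (hypercube d).Subgraph) :
    ∫ ω, (compIndicator G ω : ℝ) ∂(edgeMeasure p d) =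
      ∏ e ∈ touchingEdges G, edgeWeight p (edgeStatus G e) := by
  classical
  rw [← edgeMeasure_real_cylinder]
  have h : (fun ω => (compIndicator G ω : ℝ)) = (compEvent G).indicator 1 := by
    ext ω
    simp [compIndicator, Set.indicator_apply]
  rw [h, integral_indicator_one (by measurability)]
  rfl

theorem indepFun_of_dependsOn {d : ℕ} {β γ : Type*} [Nonempty β] [Nonempty γ] [MeasurableSpace β]
    [MeasurableSpace γ] {S : Finset (hypercube d).edgeSet} {f : EdgeConfig d → β}
    {g : EdgeConfig d → γ} (hf : DependsOn f S) (hg : DependsOn g (S : Set _)ᶜ) :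
    IndepFun f g (edgeMeasure p d) := by
  classical
  have hg' : DependsOn g ((Finset.univ \ S : Finset _) : Set (hypercube d).edgeSet) := by
    rwa [Finset.coe_sdiff, Finset.coe_univ, ← Set.compl_eq_univ_sdiff]
  obtain ⟨f', rfl⟩ := dependsOn_iff_exists_comp.1 hf
  obtain ⟨g', rfl⟩ := dependsOn_iff_exists_comp.1 hg'
  have hi : iIndepFun (fun (e : (hypercube d).edgeSet) (ω : EdgeConfig d) => ω e)
      (edgeMeasure p d) :=
    iIndepFun_pi (X := fun _ => id) fun _ => aemeasurable_id
  have := hi.indepFun_finset S (Finset.univ \ S) Finset.disjoint_sdiff fun e => measurable_pi_apply e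
  exact this.comp (φ := f') (ψ := g') Measurable.of_discrete Measurable.of_discrete

theorem dependsOn_compIndicator (G : (hypercube d).Subgraph) :
    DependsOn (compIndicator G) (touchingEdges G : Set (hypercube d).edgeSet) := by
  classical
  intro ω ω' h
  have : ω ∈ compEvent G ↔ ω' ∈ compEvent G :=
    forall₂_congr fun e he => by rw [h e he]
  simp only [compIndicator, this]

end Probability

/-! ### Edge counts and component probabilities -/

section Count

variable {d : ℕ}

theorem card_incident_edges (v : Fin d → Bool) [DecidablePred fun e : (hypercube d).edgeSet => v ∈ e.1] :
    (Finset.univ.filter fun e : (hypercube d).edgeSet => v ∈ e.1).card = d := by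
  refine Eq.trans ?_ (Finset.card_fin d)
  symm
  refine Finset.card_bij (fun i _ => (⟨s(v, Function.update v i (!v i)),
    hypercube_adj_iff_exists_update.2 ⟨i, rfl⟩⟩ : (hypercube d).edgeSet)) ?_ ?_ ?_
  · intro i _
    simp
  · intro i _ j _ h
    have h' := Sym2.congr_right.1 (congrArg Subtype.val h)
    by_contra hij
    have := congrFun h' i
    simp [Function.update_of_ne hij] at this
  · rintro ⟨e, he⟩ hv
    obtain ⟨w, rfl⟩ := Sym2.mem_iff_exists.1 (Finset.mem_filter.1 hv).2
    have hvw : (hypercube d).Adj v w := he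
    obtain ⟨i, rfl⟩ := hypercube_adj_iff_exists_update.1 hvw
    exact ⟨i, Finset.mem_univ _, rfl⟩

/-- Double counting of incidences: each of the `v` vertices has degree `d`, and an edge meeting `G`
is counted twice precisely when both ends lie in `G`, that is, when it is counted by `e` or `e'`. -/
theorem card_touchingEdges_add (G : (hypercube d).Subgraph) :
    (touchingEdges G).card + (numEdges ⟨d, G⟩ + numMissingEdges ⟨d, G⟩) = d * size ⟨d, G⟩ := by
  classical
  let B : Finset (hypercube d).edgeSet := {e | ∀ v ∈ e.1, v ∈ G.verts}
  have hB : numEdges ⟨d, G⟩ + numMissingEdges ⟨d, G⟩ = B.card := by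
    rw [numEdges, numMissingEdges, ← Set.ncard_union_eq, ← Finset.card_map ⟨_, Subtype.val_injective⟩,
      ← Set.ncard_coe_finset]
    · congr 1
      ext e
      simp only [Set.mem_union, Set.mem_ofPred_eq, Finset.coe_map, Set.mem_image, Finset.mem_coe, B,
        Finset.mem_filter, Finset.mem_univ, true_and, Function.Embedding.coeFn_mk, Subtype.exists,
        exists_and_left, exists_prop, exists_eq_right_right]
      constructor
      · rintro (h | ⟨h1, h2, h3⟩)
        · exact ⟨fun v hv => G.mem_verts_of_mem_edge h hv, G.edgeSet_subset h⟩
        · exact ⟨h3, h1⟩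
      · rintro ⟨h3, h1⟩
        by_cases h : e ∈ G.edgeSet
        · exact Or.inl h
        · exact Or.inr ⟨h1, h, h3⟩
    · exact Set.disjoint_left.2 fun e h h' => h'.2.1 h
  let V : Finset (Fin d → Bool) := {v | v ∈ G.verts}
  have hV : size ⟨d, G⟩ = V.card := by
    rw [size, ← Set.ncard_coe_finset]
    congr 1
    ext v
    simp [V]
  have h1 : ∑ v ∈ V, (Finset.univ.filter fun e : (hypercube d).edgeSet => v ∈ e.1).card =
      d * V.card := by
    rw [Finset.sum_congr rfl fun v _ => card_incident_edges v, Finset.sum_const, smul_eq_mul,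
      mul_comm]
  have h2 : ∀ e : (hypercube d).edgeSet, (V.filter fun v => v ∈ e.1).card =
      (if e ∈ touchingEdges G then 1 else 0) + if e ∈ B then 1 else 0 := by
    rintro ⟨e, he⟩
    induction e with | _ x y => ?_
    have hxy : x ≠ y := (hypercube d).ne_of_adj he
    have hf : (V.filter fun v => v ∈ s(x, y)) = ({x, y} : Finset _).filter (· ∈ G.verts) := by
      ext v
      simp [V, and_comm]
    rw [hf]
    by_cases hx : x ∈ G.verts <;> by_cases hy : y ∈ G.verts <;>
      simp [mem_touchingEdges, B, Finset.filter_insert, Finset.filter_singleton, hx, hy, hxy]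
  rw [hB, hV, ← h1]
  simp only [Finset.card_filter]
  rw [Finset.sum_comm]
  simp only [← Finset.card_filter, h2]
  rw [Finset.sum_add_distrib]
  simp

theorem card_touchingEdges_filter (G : (hypercube d).Subgraph)
    [DecidablePred fun e : (hypercube d).edgeSet => edgeStatus G e = true] :
    ((touchingEdges G).filter fun e => edgeStatus G e = true).card = numEdges ⟨d, G⟩ := by
  rw [numEdges, ← Finset.card_map ⟨_, Subtype.val_injective⟩, ← Set.ncard_coe_finset]
  congr 1
  ext e
  simp only [Finset.coe_map, Set.mem_image, Finset.mem_coe, Finset.mem_filter,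
    Function.Embedding.coeFn_mk, Subtype.exists, exists_and_right, exists_eq_right,
    mem_touchingEdges]
  simp only [edgeStatus, decide_eq_true_eq]
  constructor
  · rintro ⟨-, -, h⟩
    exact h
  · intro h
    refine ⟨G.edgeSet_subset h, ?_, h⟩
    induction e with | _ x y => ?_
    exact ⟨x, by simp, G.edge_vert h⟩

variable (p : unitInterval)

theorem prod_edgeWeight_edgeStatus (hp : (p : ℝ) < 1) (G : (hypercube d).Subgraph) :
    ∏ e ∈ touchingEdges G, edgeWeight p (edgeStatus G e) =
      ((p : ℝ) / (1 - p) ^ 2) ^ numEdges ⟨d, G⟩ * (1 / (1 - (p : ℝ))) ^ numMissingEdges ⟨d, G⟩ *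
        ((1 - (p : ℝ)) ^ size ⟨d, G⟩) ^ d := by
  have hq : (1 - (p : ℝ)) ≠ 0 := by linarith
  simp only [edgeWeight]
  rw [Finset.prod_ite, Finset.prod_const, Finset.prod_const, card_touchingEdges_filter]
  have h1 := Finset.card_filter_add_card_filter_not (s := touchingEdges G)
    fun e => edgeStatus G e = true
  rw [card_touchingEdges_filter] at h1
  have h2 := card_touchingEdges_add G
  rw [← pow_mul, mul_comm (size ⟨d, G⟩), ← h2, ← h1]
  generalize ((touchingEdges G).filter fun e => ¬ edgeStatus G e = true).card = m
  generalize numEdges ⟨d, G⟩ = a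
  generalize numMissingEdges ⟨d, G⟩ = b
  rw [div_pow, one_div, inv_pow, pow_add, pow_add, pow_add, ← pow_mul, mul_comm 2 a, mul_two, pow_add]
  field_simp

/-- The probability that a given copy of `H` is a component. -/
noncomputable def compProb (p : ℝ) (d : ℕ) (H : CubeSubgraph) : ℝ :=
  (p / (1 - p) ^ 2) ^ H.numEdges * (1 / (1 - p)) ^ H.numMissingEdges * ((1 - p) ^ H.size) ^ d

theorem integral_compIndicator_cubeCopy (hp : (p : ℝ) < 1) {H : CubeSubgraph}
    (hH : H.2.Connected) (G : CubeCopy d H) :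
    ∫ ω, (compIndicator G.1 ω : ℝ) ∂(edgeMeasure p d) = compProb p d H := by
  rw [integral_compIndicator, prod_edgeWeight_edgeStatus p hp, CubeCopy.size_eq hH,
    CubeCopy.numEdges_eq hH, CubeCopy.numMissingEdges_eq hH]
  rfl

theorem sum_integral_compIndicator (hp : (p : ℝ) < 1) {H : CubeSubgraph} (hH : H.2.Connected) :
    ∑ G : CubeCopy d H, ∫ ω, (compIndicator G.1 ω : ℝ) ∂(edgeMeasure p d) =
      H.beta p * d.descFactorial H.span * (2 * (1 - (p : ℝ)) ^ H.size) ^ d := by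
  rw [Finset.sum_congr rfl fun G _ => integral_compIndicator_cubeCopy p hp hH G, Finset.sum_const,
    Finset.card_univ, ← Nat.card_eq_fintype_card, CubeCopy.card_eq hH, nsmul_eq_mul,
    Nat.descFactorial_eq_factorial_mul_choose, CubeSubgraph.beta, compProb]
  rcases le_or_gt H.span d with h | h
  · have h2 : (2 : ℝ) ^ d = 2 ^ (d - H.span) * 2 ^ H.span := by
      rw [← pow_add, Nat.sub_add_cancel h]
    rw [mul_pow, h2]
    push_cast
    have : (H.span.factorial : ℝ) ≠ 0 := by positivity
    field_simp
  -- If the span exceeds `d` there are no copies, and the falling factorial vanishes too.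
  · simp [Nat.choose_eq_zero_of_lt h]

/-! ### Pairs of dependent components -/

theorem edgeWeight_ge (hp1 : (p : ℝ) < 1 / 2) (b : Bool) :
    (p : ℝ) ≤ edgeWeight p b := by
  unfold edgeWeight
  split_ifs <;> linarith

theorem card_touchingEdges_inter_le {G G' : (hypercube d).Subgraph}
    [DecidableEq (hypercube d).edgeSet] (hV : Disjoint G.verts G'.verts) :
    (touchingEdges G ∩ touchingEdges G').card ≤ size ⟨d, G⟩ * size ⟨d, G'⟩ := by
  rw [← Finset.card_map ⟨_, Subtype.val_injective⟩, ← Set.ncard_coe_finset, size, size,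
    ← Set.ncard_prod]
  refine (Set.ncard_le_ncard (t := (fun x => s(x.1, x.2)) '' (G.verts ×ˢ G'.verts)) ?_
    (Set.toFinite _)).trans (Set.ncard_image_le (Set.toFinite _))
  intro e he
  simp only [Finset.coe_map, Set.mem_image, Finset.mem_coe, Finset.mem_inter,
    Function.Embedding.coeFn_mk] at he
  obtain ⟨⟨e, he⟩, ⟨h1, h2⟩, rfl⟩ := he
  obtain ⟨x, hxe, hx⟩ := mem_touchingEdges.1 h1
  obtain ⟨y, rfl⟩ := Sym2.mem_iff_exists.1 hxe
  obtain ⟨z, hze, hz⟩ := mem_touchingEdges.1 h2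
  rcases Sym2.mem_iff.1 hze with rfl | rfl
  · exact (Set.disjoint_left.1 hV hx hz).elim
  · exact ⟨(x, z), ⟨hx, hz⟩, rfl⟩

/-- If the vertex sets meet, the two events exclude each other. Otherwise every shared touching edge
joins `G` to `G'`, so there are at most `v v'` of them. Counting their weights only once gains at
most a factor `1 / p` per edge, as `p` is the smaller of the two weights. -/
theorem integral_compIndicator_mul_le (hp0 : 0 < (p : ℝ)) (hp1 : (p : ℝ) < 1 / 2)
    {G G' : (hypercube d).Subgraph} (hG : G.Connected) (hG' : G'.Connected) (hne : G ≠ G') :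
    ∫ ω, (compIndicator G ω : ℝ) * compIndicator G' ω ∂(edgeMeasure p d) ≤
      (1 / (p : ℝ)) ^ (size ⟨d, G⟩ * size ⟨d, G'⟩) *
        ((∫ ω, (compIndicator G ω : ℝ) ∂(edgeMeasure p d)) *
          ∫ ω, (compIndicator G' ω : ℝ) ∂(edgeMeasure p d)) := by
  classical
  have hw : ∀ b, 0 < edgeWeight p b := fun b => hp0.trans_le (edgeWeight_ge p hp1 b)
  have hind : (fun ω => (compIndicator G ω : ℝ) * compIndicator G' ω) =
      (compEvent G ∩ compEvent G').indicator 1 := by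
    ext ω
    simp only [compIndicator, Set.indicator_apply, Set.mem_inter_iff]
    by_cases h1 : ω ∈ compEvent G <;> by_cases h2 : ω ∈ compEvent G' <;> simp [h1, h2]
  rw [hind, integral_indicator_one (by measurability), integral_compIndicator,
    integral_compIndicator]
  by_cases hV : Disjoint G.verts G'.verts
  · set T := touchingEdges G
    set T' := touchingEdges G'
    set b : EdgeConfig d := fun e => if e ∈ T then edgeStatus G e else edgeStatus G' e with hb
    -- Only an inclusion: if the two prescriptions conflict on a shared edge, the left side is
    -- empty.
    have hsub : compEvent G ∩ compEvent G' ⊆ {ω | ∀ e ∈ T ∪ (T' \ T), ω e = b e} := by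
      rintro ω ⟨h, h'⟩ e he
      by_cases heT : e ∈ T
      · simp only [hb, if_pos heT]
        exact h e heT
      · simp only [hb, if_neg heT]
        refine h' e ?_
        rcases Finset.mem_union.1 he with he | he
        · exact (heT he).elim
        · exact (Finset.mem_sdiff.1 he).1
    refine (measureReal_mono hsub).trans ?_
    rw [edgeMeasure_real_cylinder, Finset.prod_union Finset.disjoint_sdiff]
    have e1 : ∏ e ∈ T, edgeWeight p (b e) = ∏ e ∈ T, edgeWeight p (edgeStatus G e) :=
      Finset.prod_congr rfl fun e he => by simp only [hb, if_pos he]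
    have e2 : ∏ e ∈ T' \ T, edgeWeight p (b e) = ∏ e ∈ T' \ T, edgeWeight p (edgeStatus G' e) :=
      Finset.prod_congr rfl fun e he => by simp only [hb, if_neg (Finset.mem_sdiff.1 he).2]
    rw [e1, e2, mul_left_comm]
    refine mul_le_mul_of_nonneg_left ?_ (Finset.prod_nonneg fun e _ => (hw _).le)
    rw [← Finset.prod_inter_mul_prod_sdiff T' T, ← mul_assoc]
    refine le_mul_of_one_le_left (Finset.prod_nonneg fun e _ => (hw _).le) ?_
    have hcard : (T' ∩ T).card ≤ size ⟨d, G⟩ * size ⟨d, G'⟩ := by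
      rw [Finset.inter_comm]
      exact card_touchingEdges_inter_le hV
    have hp1' : (p : ℝ) ≤ 1 := by linarith
    have h3 : (p : ℝ) ^ (size ⟨d, G⟩ * size ⟨d, G'⟩) ≤
        ∏ e ∈ T' ∩ T, edgeWeight p (edgeStatus G' e) :=
      calc _ ≤ (p : ℝ) ^ (T' ∩ T).card := pow_le_pow_of_le_one hp0.le hp1' hcard
        _ = ∏ e ∈ T' ∩ T, (p : ℝ) := by rw [Finset.prod_const]
        _ ≤ _ := Finset.prod_le_prod (fun _ _ => hp0.le) fun e _ => edgeWeight_ge p hp1 _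
    calc (1 : ℝ) = (1 / (p : ℝ)) ^ (size ⟨d, G⟩ * size ⟨d, G'⟩) *
          (p : ℝ) ^ (size ⟨d, G⟩ * size ⟨d, G'⟩) := by
          rw [← mul_pow, one_div_mul_cancel hp0.ne', one_pow]
      _ ≤ _ := mul_le_mul_of_nonneg_left h3 (by positivity)
  · rw [(disjoint_compEvent hG hG' hne hV).inter_eq, measureReal_empty]
    have h1 : ∀ G : (hypercube d).Subgraph,
        0 ≤ ∏ e ∈ touchingEdges G, edgeWeight p (edgeStatus G e) := fun G =>
      Finset.prod_nonneg fun e _ => (hw _).le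
    exact mul_nonneg (by positivity) (mul_nonneg (h1 G) (h1 G'))

/-- A copy sharing a touching edge with `G` passes through a vertex of `G` or a neighbour of one.
This gives at most `d + 1` candidates per vertex of `G`, each on at most `d ^ span` copies. -/
theorem card_touching_cubeCopy_le (G : (hypercube d).Subgraph) {H : CubeSubgraph}
    (hH : H.2.Connected) [DecidablePred fun G' : CubeCopy d H =>
      ¬ Disjoint (touchingEdges G) (touchingEdges G'.1)] :
    (Finset.univ.filter fun G' : CubeCopy d H =>
      ¬ Disjoint (touchingEdges G) (touchingEdges G'.1)).card ≤
      size ⟨d, G⟩ * (d + 1) * d ^ H.span := by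
  classical
  let V : Finset (Fin d → Bool) := {v | v ∈ G.verts}
  have hV : size ⟨d, G⟩ = V.card := by
    rw [size, ← Set.ncard_coe_finset]
    congr 1
    ext v
    simp [V]
  let nb : (Fin d → Bool) × Option (Fin d) → Fin d → Bool := fun x =>
    x.2.elim x.1 fun i => Function.update x.1 i (!x.1 i)
  have hsub : (Finset.univ.filter fun G' : CubeCopy d H =>
      ¬ Disjoint (touchingEdges G) (touchingEdges G'.1)) ⊆
      (V ×ˢ (Finset.univ : Finset (Option (Fin d)))).biUnion fun x =>
        Finset.univ.filter fun G' : CubeCopy d H => nb x ∈ G'.1.verts := by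
    intro G' hG'
    obtain ⟨⟨e, he⟩, h1, h2⟩ := Finset.not_disjoint_iff.1 (Finset.mem_filter.1 hG').2
    obtain ⟨x, hxe, hx⟩ := mem_touchingEdges.1 h1
    obtain ⟨y, rfl⟩ := Sym2.mem_iff_exists.1 hxe
    obtain ⟨z, hze, hz⟩ := mem_touchingEdges.1 h2
    rw [Finset.mem_biUnion]
    rcases Sym2.mem_iff.1 hze with rfl | rfl
    · exact ⟨(z, none), by simp [V, hx], Finset.mem_filter.2 ⟨Finset.mem_univ _, hz⟩⟩
    · obtain ⟨i, hi⟩ := hypercube_adj_iff_exists_update.1 he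
      have hi' : z = nb (x, some i) := hi
      exact ⟨(x, some i), by simp [V, hx], Finset.mem_filter.2 ⟨Finset.mem_univ _, hi' ▸ hz⟩⟩
  refine (Finset.card_le_card hsub).trans ((Finset.card_biUnion_le_card_mul _ _ (d ^ H.span)
    fun x _ => ?_).trans ?_)
  · rw [← Fintype.card_subtype, ← Nat.card_eq_fintype_card]
    exact CubeCopy.card_through_le hH _
  · rw [Finset.card_product, hV]
    simp

end Count

/-! ### Poisson approximation of the component count -/

section ComponentCount

variable (p : unitInterval) {r : ℕ} (H : Fin r → CubeSubgraph)

theorem integral_componentCount_eq (hp : (p : ℝ) < 1) (hconn : ∀ i, (H i).2.Connected) (d : ℕ) :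
    ∫ ω : EdgeConfig d, ((∑ i, componentCount (H i) ω : ℕ) : ℝ) ∂(edgeMeasure p d) =
      ∑ i, (H i).beta p * d.descFactorial (H i).span * (2 * (1 - (p : ℝ)) ^ (H i).size) ^ d := by
  have int : ∀ g : EdgeConfig d → ℝ, Integrable g (edgeMeasure p d) :=
    fun g => Integrable.of_finite
  simp only [componentCount_eq_sum, Nat.cast_sum]
  rw [integral_finsetSum _ fun i _ => int _]
  refine Finset.sum_congr rfl fun i _ => ?_
  rw [integral_finsetSum _ fun i _ => int _, sum_integral_compIndicator p hp (hconn i)]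

/-- An upper bound for the expected number of components `H i` near a given subgraph with at most
`M` vertices. -/
noncomputable def nearbyBound (p : ℝ) (M d : ℕ) : ℝ :=
  ∑ i, ((M : ℝ) * (d + 1) * d ^ (H i).span + 1) * compProb p d (H i)

theorem compProb_nonneg {p : ℝ} (hp0 : 0 < p) (hp1 : p < 1) (d : ℕ) (H : CubeSubgraph) :
    0 ≤ compProb p d H := by
  have : 0 < 1 - p := by linarith
  unfold compProb
  positivity

theorem poisson_approximation_componentCount (hp0 : 0 < (p : ℝ)) (hp1 : (p : ℝ) < 1 / 2)
    (hconn : ∀ i, (H i).2.Connected) (hnoniso : Pairwise fun i j => ¬ (H i).AmbientIso (H j))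
    {M : ℕ} (hM : ∀ i, (H i).size ≤ M) (d : ℕ) {l : ℝ}
    (hl : l = ∫ ω : EdgeConfig d, ((∑ i, componentCount (H i) ω : ℕ) : ℝ) ∂(edgeMeasure p d)) :
    (0 < l → tvDist ((edgeMeasure p d).map fun ω => ∑ i, componentCount (H i) ω)
        (poissonMeasure l.toNNReal) ≤ (1 + (1 / (p : ℝ)) ^ (M * M)) * nearbyBound H p M d) ∧
      |variance (fun ω => ((∑ i, componentCount (H i) ω : ℕ) : ℝ)) (edgeMeasure p d) - l| ≤
        (1 + (1 / (p : ℝ)) ^ (M * M)) * nearbyBound H p M d * l := by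
  classical
  have hp1' : (p : ℝ) < 1 := by linarith
  let X : (Σ i, CubeCopy d (H i)) → EdgeConfig d → ℕ := fun a => compIndicator a.2.1
  let N : (Σ i, CubeCopy d (H i)) → Finset (Σ i, CubeCopy d (H i)) := fun a =>
    -- The clause `b = a` is needed when `d = 0`, where touching sets are empty; it accounts for the
    -- `+ 1` in `nearbyBound`.
    {b | b = a ∨ ¬ Disjoint (touchingEdges a.2.1) (touchingEdges b.2.1)}
  have hY : (fun ω : EdgeConfig d => ∑ i, componentCount (H i) ω) = fun ω => ∑ a, X a ω := by
    ext ω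
    simp only [componentCount_eq_sum]
    rw [Fintype.sum_sigma]
  have hYω : ∀ ω : EdgeConfig d, ∑ i, componentCount (H i) ω = ∑ a, X a ω := congrFun hY
  have hX : ∀ a ω, X a ω ≤ 1 := fun a ω => compIndicator_le_one _ _
  have hN : ∀ a, a ∈ N a := fun a => by simp [N]
  have hind : ∀ a, IndepFun (X a) (fun ω (b : {b // b ∉ N a}) => X b ω) (edgeMeasure p d) := by
    intro a
    refine indepFun_of_dependsOn p (dependsOn_compIndicator a.2.1) fun ω ω' h => ?_
    funext b
    refine dependsOn_compIndicator b.1.2.1 fun e he => h e fun hea => b.2 ?_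
    rw [Finset.mem_filter]
    exact ⟨Finset.mem_univ _, Or.inr (Finset.not_disjoint_iff.2 ⟨e, hea, he⟩)⟩
  have hprob : ∀ a, ∫ ω, (X a ω : ℝ) ∂(edgeMeasure p d) = compProb p d (H a.1) := fun a =>
    integral_compIndicator_cubeCopy p hp1' (hconn a.1) a.2
  have hnn : ∀ i, 0 ≤ compProb p d (H i) := fun i => compProb_nonneg hp0 hp1' d (H i)
  have hsz : ∀ a : Σ i, CubeCopy d (H i), size ⟨d, a.2.1⟩ ≤ M := fun a => by
    rw [CubeCopy.size_eq (hconn a.1)]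
    exact hM a.1
  have hδ : ∀ a, ∑ b ∈ N a, ∫ ω, (X b ω : ℝ) ∂(edgeMeasure p d) ≤ nearbyBound H p M d := by
    intro a
    simp only [hprob]
    have h1 : ∑ b ∈ N a, compProb p d (H b.1) ≤
        ∑ b, ((if b = a then compProb p d (H b.1) else 0) +
          if ¬ Disjoint (touchingEdges a.2.1) (touchingEdges b.2.1) then compProb p d (H b.1)
            else 0) := by
      rw [Finset.sum_filter]
      refine Finset.sum_le_sum fun b _ => ?_
      have := hnn b.1
      split_ifs with h1 h2 h3 h2 h3 <;> first | linarith | tauto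
    refine h1.trans ?_
    rw [Finset.sum_add_distrib, Finset.sum_ite_eq' Finset.univ a, if_pos (Finset.mem_univ a),
      Fintype.sum_sigma]
    have h2 : compProb p d (H a.1) ≤ ∑ i, compProb p d (H i) :=
      Finset.single_le_sum (f := fun i => compProb p d (H i)) (fun i _ => hnn i)
        (Finset.mem_univ a.1)
    refine (add_le_add_left h2 _).trans ?_
    rw [nearbyBound, ← Finset.sum_add_distrib]
    refine Finset.sum_le_sum fun i _ => ?_
    have h3 : ∑ G : CubeCopy d (H i), (if ¬ Disjoint (touchingEdges a.2.1) (touchingEdges G.1)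
        then compProb p d (H i) else 0) ≤
          ((M : ℝ) * (d + 1) * d ^ (H i).span) * compProb p d (H i) := by
      rw [← Finset.sum_filter, Finset.sum_const, nsmul_eq_mul]
      refine mul_le_mul_of_nonneg_right ?_ (hnn i)
      have h4 := card_touching_cubeCopy_le a.2.1 (hconn i)
      have h5 : size ⟨d, a.2.1⟩ * (d + 1) * d ^ (H i).span ≤ M * (d + 1) * d ^ (H i).span :=
        Nat.mul_le_mul_right _ (Nat.mul_le_mul_right _ (hsz a))
      exact_mod_cast h4.trans h5
    rw [add_mul, one_mul, add_comm]
    exact add_le_add_left h3 _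
  have hpair : ∀ a, ∀ b ∈ N a, b ≠ a →
      ∫ ω, (X a ω : ℝ) * X b ω ∂(edgeMeasure p d) ≤ (1 / (p : ℝ)) ^ (M * M) *
        ((∫ ω, (X a ω : ℝ) ∂(edgeMeasure p d)) * ∫ ω, (X b ω : ℝ) ∂(edgeMeasure p d)) := by
    rintro ⟨i, G⟩ ⟨j, G'⟩ - hne
    -- Distinct indices carry distinct subgraphs, because one subgraph cannot be a copy of two
    -- non-isomorphic `H i`.
    have hGG : G.1 ≠ G'.1 := by
      intro h
      by_cases hij : i = j
      · subst hij
        exact hne (congrArg (Sigma.mk i) (Subtype.ext h.symm))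
      · refine hnoniso hij ?_
        have h1 : AmbientIso ⟨d, G.1⟩ (H i) := G.2.2
        have h2 : AmbientIso ⟨d, G'.1⟩ (H j) := G'.2.2
        rw [h] at h1
        exact h1.symm.trans h2
    refine (integral_compIndicator_mul_le p hp0 hp1 G.2.1 G'.2.1 hGG).trans ?_
    refine mul_le_mul_of_nonneg_right ?_ ?_
    · refine pow_le_pow_right₀ ?_ (Nat.mul_le_mul (hsz ⟨i, G⟩) (hsz ⟨j, G'⟩))
      rw [le_div_iff₀ hp0]
      linarith
    · exact mul_nonneg (integral_nonneg fun ω => Nat.cast_nonneg _)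
        (integral_nonneg fun ω => Nat.cast_nonneg _)
  have hK : 0 ≤ (1 / (p : ℝ)) ^ (M * M) := by positivity
  simp only [hYω] at hl ⊢
  exact ⟨tvDist_sum_indicators_poisson_le hX hN hind hK hδ hpair hl,
    abs_variance_sum_indicators_sub_le hX hN hind hK hδ hpair hl⟩

end ComponentCount

/-! ### Asymptotics -/

section Asymptotic

variable {q : ℝ}

theorem tendsto_mul_pow_self (hq0 : 0 < q) (hq1 : q < 1) :
    Tendsto (fun d : ℕ => (d : ℝ) * q ^ d) atTop (𝓝 0) :=
  tendsto_self_mul_const_pow_of_lt_one hq0.le hq1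

theorem isBigO_pow_of_tendsto_zero {u : ℕ → ℝ} (hu : Tendsto u atTop (𝓝 0)) {t v : ℕ}
    (h : t ≤ v) : (fun d => u d ^ v) =O[atTop] fun d => u d ^ t := by
  obtain ⟨j, rfl⟩ := Nat.exists_eq_add_of_le h
  simp only [pow_add]
  simpa using (isBigO_refl (fun d => u d ^ t) atTop).mul ((hu.isBigO_one ℝ).pow j)

/-- The inequality `span + 1 ≤ size` lets the polynomial factor be absorbed, giving `(d q^d)^size`;
as `d q^d` tends to zero, the smallest size dominates. -/
theorem nearbyBound_isBigO {p : ℝ} (hp0 : 0 < p) (hp1 : p < 1) {r : ℕ} {H : Fin r → CubeSubgraph}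
    (hconn : ∀ i, (H i).2.Connected) {t : ℕ} (ht : ∀ i, t ≤ (H i).size) (M : ℕ) :
    nearbyBound H p M =O[atTop] fun d : ℕ => ((d : ℝ) * (1 - p) ^ d) ^ t := by
  unfold nearbyBound
  refine IsBigO.fun_sum fun i _ => ?_
  refine IsBigO.trans ?_ (isBigO_pow_of_tendsto_zero
    (tendsto_mul_pow_self (q := 1 - p) (by linarith) (by linarith)) (ht i))
  have h1 : (fun d : ℕ => (M : ℝ) * (d + 1) * d ^ (H i).span + 1) =O[atTop]
      fun d : ℕ => (d : ℝ) ^ (H i).size := by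
    refine IsBigO.of_bound (2 * M + 1) ?_
    filter_upwards [eventually_ge_atTop 1] with d hd
    have hd' : (1 : ℝ) ≤ d := by exact_mod_cast hd
    have hs : (d : ℝ) ^ ((H i).span + 1) ≤ (d : ℝ) ^ (H i).size :=
      pow_le_pow_right₀ hd' (span_lt_size (hconn i))
    have h1 : (1 : ℝ) ≤ (d : ℝ) ^ (H i).size := one_le_pow₀ hd'
    rw [Real.norm_of_nonneg (by positivity), Real.norm_of_nonneg (by positivity)]
    have h2 : (M : ℝ) * (d + 1) * d ^ (H i).span ≤ 2 * M * (d : ℝ) ^ (H i).size := by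
      calc (M : ℝ) * (d + 1) * d ^ (H i).span ≤ M * (d + d) * d ^ (H i).span := by gcongr
        _ = 2 * M * (d : ℝ) ^ ((H i).span + 1) := by ring
        _ ≤ _ := by gcongr
    linarith
  have h2 : (fun d => compProb p d (H i)) =O[atTop] fun d : ℕ => ((1 - p) ^ d) ^ (H i).size := by
    unfold compProb
    simp only [← pow_mul, mul_comm _ (H i).size]
    exact isBigO_const_mul_self _ _ _
  simpa only [mul_pow] using h1.mul h2

theorem descFactorial_div_isBigO (a b : ℕ) :
    (fun d : ℕ => (d.descFactorial a : ℝ) / d.descFactorial b) =O[atTop]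
      fun d : ℕ => (d : ℝ) ^ a / (d : ℝ) ^ b :=
  ((isEquivalent_descFactorial a).div (isEquivalent_descFactorial b)).isBigO

theorem pow_div_pow_mul_pow_isBigO_of_lt {a b j : ℕ} (h : a < b) (hq0 : 0 < q) (hq1 : q < 1) :
    (fun d : ℕ => (d : ℝ) ^ a / (d : ℝ) ^ b * (q ^ d) ^ j) =O[atTop] fun d : ℕ => 1 / (d : ℝ) := by
  refine IsBigO.of_bound 1 ?_
  filter_upwards [eventually_ge_atTop 1] with d hd
  have hd' : (1 : ℝ) ≤ d := by exact_mod_cast hd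
  rw [Real.norm_of_nonneg (by positivity), Real.norm_of_nonneg (by positivity), one_mul]
  have h1 : (q ^ d) ^ j ≤ 1 := pow_le_one₀ (by positivity) (pow_le_one₀ hq0.le hq1.le)
  refine (mul_le_of_le_one_right (by positivity) h1).trans ?_
  rw [div_le_div_iff₀ (by positivity) (by positivity), one_mul, ← pow_succ]
  exact pow_le_pow_right₀ hd' h

theorem pow_div_pow_mul_pow_isBigO_of_pos {j : ℕ} (a b : ℕ) (hj : 1 ≤ j) (hq0 : 0 < q)
    (hq1 : q < 1) :
    (fun d : ℕ => (d : ℝ) ^ a / (d : ℝ) ^ b * (q ^ d) ^ j) =O[atTop] fun d : ℕ => 1 / (d : ℝ) := by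
  have h0 : (fun d : ℕ => (d : ℝ) ^ (a + 1) * q ^ d) =O[atTop] fun _ => (1 : ℝ) :=
    (tendsto_pow_const_mul_const_pow_of_abs_lt_one (a + 1)
      (abs_lt.2 ⟨by linarith, hq1⟩)).isBigO_one ℝ
  have h1 : (fun d : ℕ => (d : ℝ) ^ (a + 1) * q ^ d * (1 / (d : ℝ))) =O[atTop]
      fun d : ℕ => 1 / (d : ℝ) := by
    simpa using h0.mul (isBigO_refl (fun d : ℕ => 1 / (d : ℝ)) atTop)
  refine IsBigO.trans (IsBigO.of_bound 1 ?_) h1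
  filter_upwards [eventually_ge_atTop 1] with d hd
  have hd' : (1 : ℝ) ≤ d := by exact_mod_cast hd
  rw [Real.norm_of_nonneg (by positivity), Real.norm_of_nonneg (by positivity), one_mul]
  have e : (d : ℝ) ^ (a + 1) * q ^ d * (1 / (d : ℝ)) = (d : ℝ) ^ a * q ^ d := by
    rw [pow_succ]
    field_simp
  rw [e]
  have h2 : (q ^ d) ^ j ≤ q ^ d :=
    pow_le_of_le_one (by positivity) (pow_le_one₀ hq0.le hq1.le) (by omega)
  exact mul_le_mul (div_le_self (by positivity) (one_le_pow₀ hd')) h2 (by positivity)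
    (by positivity)

theorem pow_div_pow_mul_pow_isBigO_self {a b j : ℕ} (h : a ≤ b + j) (hj : 1 ≤ j) (hq0 : 0 < q)
    (hq1 : q < 1) :
    (fun d : ℕ => (d : ℝ) ^ a / (d : ℝ) ^ b * (q ^ d) ^ j) =O[atTop]
      fun d : ℕ => (d : ℝ) * q ^ d := by
  have h1 := isBigO_pow_of_tendsto_zero (tendsto_mul_pow_self hq0 hq1) hj
  simp only [pow_one] at h1
  refine IsBigO.trans (IsBigO.of_bound 1 ?_) h1
  filter_upwards [eventually_ge_atTop 1] with d hd
  have hd' : (1 : ℝ) ≤ d := by exact_mod_cast hd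
  rw [Real.norm_of_nonneg (by positivity), Real.norm_of_nonneg (by positivity), one_mul, mul_pow]
  refine mul_le_mul_of_nonneg_right ?_ (by positivity)
  rw [div_le_iff₀ (by positivity), ← pow_add, add_comm]
  exact pow_le_pow_right₀ hd' h

/-- The ratio of the contribution of a graph of size `t + j` and span `a` to the leading term with
size `t` and span `b`: up to a constant it is `d^(a - b) q^(jd)`. -/
theorem descFactorial_ratio_isBigO {h : ℕ → ℝ} {a b j t : ℕ} (B c : ℝ) (hq0 : 0 < q)
    (hh : (fun d : ℕ => (d : ℝ) ^ a / (d : ℝ) ^ b * (q ^ d) ^ j) =O[atTop] h) :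
    (fun d : ℕ => B * d.descFactorial a * (2 * q ^ (t + j)) ^ d /
      (c * d.descFactorial b * (2 * q ^ t) ^ d)) =O[atTop] h := by
  have e : (fun d : ℕ => B * d.descFactorial a * (2 * q ^ (t + j)) ^ d /
      (c * d.descFactorial b * (2 * q ^ t) ^ d)) = fun d : ℕ =>
        B / c * ((d.descFactorial a : ℝ) / d.descFactorial b * (q ^ d) ^ j) := by
    ext d
    have h2 : (2 * q ^ (t + j)) ^ d = (2 * q ^ t) ^ d * (q ^ d) ^ j := by
      rw [pow_add, ← mul_assoc, mul_pow, ← pow_mul q j, mul_comm j, pow_mul]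
    rw [h2]
    have : (2 * q ^ t) ^ d ≠ 0 := by positivity
    field_simp
  rw [e]
  exact (((descFactorial_div_isBigO a b).mul (isBigO_refl _ _)).trans hh).const_mul_left _

theorem eqOneAddBigOMul_sum {ι : Type*} [Fintype ι] {P : ι → Prop} [DecidablePred P]
    {F : ι → ℕ → ℝ} {g h : ℕ → ℝ} (hg : ∀ d, ∑ i with P i, F i d = g d)
    (hg0 : ∀ᶠ d in atTop, g d ≠ 0)
    (hF : ∀ i, ¬ P i → (fun d => F i d / g d) =O[atTop] h) :
    EqOneAddBigOMul (fun d => ∑ i, F i d) h g := by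
  refine ⟨fun d => ∑ i with ¬ P i, F i d / g d,
    IsBigO.fun_sum fun i hi => hF i (Finset.mem_filter.1 hi).2, ?_⟩
  filter_upwards [hg0] with d hd
  rw [← Finset.sum_filter_add_sum_filter_not Finset.univ P, hg, ← Finset.sum_div, add_mul,
    div_mul_cancel₀ _ hd, one_mul]

/-- For `s ≥ 1` the falling factorial is already linear and `2 q^t ≥ 1` suffices. For `s = 0`
necessarily `t = 1`, and `2q > 1` gives exponential growth, bounded below by Bernoulli's inequality.
-/
theorem exists_linear_lower_bound {s t : ℕ} (hst : t ≤ 2 ^ s) (ht : 1 ≤ t) (hq0 : 1 / 2 < q)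
    (hqt : 1 ≤ 2 * q ^ t) {c : ℝ} (hc : 0 < c) :
    ∃ c' : ℝ, 0 < c' ∧ ∀ᶠ d : ℕ in atTop,
      c' * d ≤ c * d.descFactorial s * (2 * q ^ t) ^ d := by
  rcases Nat.eq_zero_or_pos s with rfl | hs
  · obtain rfl : t = 1 := by simpa using le_antisymm hst ht
    refine ⟨c * (2 * q - 1), mul_pos hc (by linarith), Eventually.of_forall fun d => ?_⟩
    have := one_add_mul_le_pow (a := 2 * q - 1) (by linarith) d
    rw [add_sub_cancel] at this
    simp only [Nat.descFactorial_zero, Nat.cast_one, mul_one, pow_one]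
    rw [mul_assoc]
    exact mul_le_mul_of_nonneg_left (by linarith) hc.le
  · refine ⟨c / 2, by positivity, ?_⟩
    filter_upwards [eventually_ge_atTop (2 * s)] with d hd
    have h1 : d + 1 - s ≤ d.descFactorial s :=
      (Nat.le_self_pow (by omega) _).trans (Nat.pow_sub_le_descFactorial d s)
    have h2 : d ≤ 2 * d.descFactorial s := by omega
    have h3 : (d : ℝ) ≤ 2 * d.descFactorial s := by exact_mod_cast h2
    have h4 : 1 ≤ (2 * q ^ t) ^ d := one_le_pow₀ hqt
    calc c / 2 * d ≤ c * d.descFactorial s := by nlinarith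
      _ ≤ _ := le_mul_of_one_le_right (by positivity) h4

theorem one_le_two_mul_pow_of_le_maxSmallSize {p : ℝ} (hp0 : 0 < p) (hp1 : p < 1) {t : ℕ}
    (ht : t ≤ maxSmallSize p) : 1 ≤ 2 * (1 - p) ^ t := by
  have hq : 0 < 1 - p := by linarith
  have hlog : 0 < Real.logb 2 (1 / (1 - p)) :=
    Real.logb_pos (by norm_num) (by rw [lt_div_iff₀ hq]; linarith)
  have h1 := (Nat.le_floor_iff (by positivity)).1 ht
  rw [le_div_iff₀ hlog, ← Real.logb_pow, Real.logb_le_iff_le_rpow (by norm_num) (by positivity),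
    Real.rpow_one, one_div, inv_pow, inv_le_iff_one_le_mul₀ (by positivity)] at h1
  exact h1

end Asymptotic

/-! ### Events of very high probability -/

theorem withVeryHighProb_of_isLittleO {p : unitInterval} {E : ∀ d, Set (EdgeConfig d)} {f : ℕ → ℝ}
    {γ : ℝ} (hγ : 0 < γ) (hf : f =o[atTop] fun d : ℕ => Real.exp (-(γ * d)))
    (hE : ∀ᶠ d in atTop, (edgeMeasure p d).real (E d)ᶜ ≤ f d) : WithVeryHighProb p E := by
  refine ⟨γ, hγ, ?_⟩
  filter_upwards [hE, hf.bound one_pos] with d h1 h2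
  rw [probReal_compl_eq_one_sub (by measurability)] at h1
  rw [Real.norm_of_nonneg (Real.exp_pos _).le, one_mul] at h2
  have := (le_abs_self _).trans h2
  linarith

theorem WithVeryHighProb.mono {p : unitInterval} {E E' : ∀ d, Set (EdgeConfig d)}
    (h : WithVeryHighProb p E) (hE : ∀ᶠ d in atTop, E d ⊆ E' d) : WithVeryHighProb p E' := by
  obtain ⟨γ, hγ, h⟩ := h
  refine ⟨γ, hγ, ?_⟩
  filter_upwards [h, hE] with d h1 h2
  exact h1.trans (measureReal_mono h2)

theorem withVeryHighProb_abs_sub_lt_of_tvDist {p : unitInterval} {q : ℝ} (hq0 : 0 < q) (hq1 : q < 1)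
    {Y : ∀ d, EdgeConfig d → ℕ} {l : ℕ → ℝ} {c' : ℝ} (hc' : 0 < c')
    (hl : ∀ᶠ d : ℕ in atTop, c' * d ≤ l d)
    (htv : (fun d => tvDist ((edgeMeasure p d).map (Y d)) (poissonMeasure (l d).toNNReal))
      =O[atTop] fun d : ℕ => (d : ℝ) * q ^ d) {ε : ℝ} (hε : 0 < ε) :
    WithVeryHighProb p fun d => {ω | |(Y d ω : ℝ) - l d| < ε * √(d * l d)} := by
  -- The cap `2 √c'`, together with `c' d ≤ l d`, keeps the deviation `ε' √(d l)` below `2 l`, the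
  -- range of the Poisson tail bound.
  set ε' := min ε (2 * √c') with hε'
  have hε'0 : 0 < ε' := lt_min hε (by positivity)
  have hlogq : 0 < -Real.log q := neg_pos.2 (Real.log_neg hq0 hq1)
  -- Half the smaller of the decay rates of the Poisson tail and of `q^d`, so that constants and the
  -- factor `d` are absorbed.
  set γ := min (ε' ^ 2 / 4) (-Real.log q) / 2 with hγ
  have hmin : 0 < min (ε' ^ 2 / 4) (-Real.log q) := lt_min (by positivity) hlogq
  have hγ0 : 0 < γ := by positivity
  have hγ1 : γ < ε' ^ 2 / 4 := (half_lt_self hmin).trans_le (min_le_left _ _)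
  have hγ2 : γ < -Real.log q := (half_lt_self hmin).trans_le (min_le_right _ _)
  have hexp : ∀ a : ℝ, (fun d : ℕ => Real.exp (-(a * d))) = fun d : ℕ => Real.exp (-a) ^ d :=
    fun a => by
      ext d
      rw [← Real.exp_nat_mul]
      congr 1
      ring
  refine withVeryHighProb_of_isLittleO (f := fun d => 2 * Real.exp (-(ε' ^ 2 / 4 * d)) +
    2 * tvDist ((edgeMeasure p d).map (Y d)) (poissonMeasure (l d).toNNReal)) hγ0 ?_ ?_
  · refine IsLittleO.add (IsLittleO.const_mul_left ?_ 2)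
      (IsLittleO.const_mul_left (htv.trans_isLittleO ?_) 2)
    · rw [hexp, hexp]
      exact isLittleO_pow_pow_of_lt_left (Real.exp_pos _).le (Real.exp_lt_exp.2 (by linarith))
    · rw [hexp]
      have h := isLittleO_pow_const_mul_const_pow_const_pow_of_norm_lt (R := ℝ) 1 (r₁ := q)
        (r₂ := Real.exp (-γ)) (by
          rw [Real.norm_of_nonneg hq0.le, ← Real.log_lt_iff_lt_exp hq0]
          linarith)
      simpa using h
  · filter_upwards [hl, eventually_ge_atTop 1] with d hd hd1
    have hd0 : (0 : ℝ) < d := by exact_mod_cast hd1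
    have hl0 : 0 < l d := lt_of_lt_of_le (by positivity) hd
    have hYm : Measurable (Y d) := Measurable.of_discrete
    have := Measure.isProbabilityMeasure_map (μ := edgeMeasure p d) hYm.aemeasurable
    set x := ε' * √(d * l d) with hx
    have hxl : x ≤ 2 * l d := by
      calc x ≤ 2 * √c' * √(d * l d) :=
            mul_le_mul_of_nonneg_right (min_le_right _ _) (Real.sqrt_nonneg _)
        _ = 2 * √(c' * d * l d) := by rw [mul_assoc, ← Real.sqrt_mul hc'.le, mul_assoc c']
        _ ≤ 2 * √(l d * l d) := by gcongr
        _ = 2 * l d := by rw [Real.sqrt_mul_self hl0.le]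
    have hx2 : x ^ 2 / (4 * l d) = ε' ^ 2 / 4 * d := by
      rw [hx, mul_pow, Real.sq_sqrt (by positivity)]
      field_simp
    have hsub : {ω | |(Y d ω : ℝ) - l d| < ε * √(d * l d)}ᶜ ⊆
        Y d ⁻¹' {k | x ≤ |(k : ℝ) - l d|} := by
      intro ω hω
      have h1 : ε * √(d * l d) ≤ |(Y d ω : ℝ) - l d| := not_lt.1 hω
      exact (mul_le_mul_of_nonneg_right (min_le_left _ _) (Real.sqrt_nonneg _)).trans h1
    calc _ ≤ (edgeMeasure p d).real (Y d ⁻¹' {k | x ≤ |(k : ℝ) - l d|}) := measureReal_mono hsub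
      _ = ((edgeMeasure p d).map (Y d)).real {k | x ≤ |(k : ℝ) - l d|} :=
          (map_measureReal_apply hYm (by measurability)).symm
      _ ≤ _ := measureReal_le_add_tvDist _ (poissonMeasure (l d).toNNReal) _
      _ ≤ _ := by
          have h := poissonMeasure_real_abs_sub_ge_le hl0 (x := x) (by positivity) hxl
          rw [hx2] at h
          linarith

/-! ### The main theorem -/

theorem theorem5
    (p : unitInterval) (hp0 : 0 < (p : ℝ)) (hp1 : (p : ℝ) < 1 / 2)
    (q : ℝ) (hq : q = 1 - p)
    (r : ℕ) (hr : 1 ≤ r) (H : Fin r → CubeSubgraph)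
    (hconn : ∀ i, (H i).2.Connected)
    (hsize : ∀ i, (H i).size ≤ maxSmallSize p)
    (hnoniso : Pairwise fun i j => ¬ (H i).AmbientIso (H j))
    (t : ℕ) (ht : IsLeast {n | ∃ i, (H i).size = n} t)
    (s : ℕ) (hs : IsGreatest {n | ∃ i, (H i).size = t ∧ (H i).span = n} s)
    (c : ℝ) (hc : c = ∑ i with (H i).size = t ∧ (H i).span = s, (H i).beta p)
    (Y : ∀ d, EdgeConfig d → ℕ) (hY : ∀ d ω, Y d ω = ∑ i, componentCount (H i) ω)
    (lam : ℕ → ℝ) (hlam : ∀ d, lam d = ∫ ω, (Y d ω : ℝ) ∂(edgeMeasure p d))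
    (V : ℕ → ℝ) (hV : ∀ d, V d = variance (fun ω => (Y d ω : ℝ)) (edgeMeasure p d)) :
    -- (a)
    (0 < c ∧
      EqOneAddBigOMul lam (fun d => 1 / (d : ℝ))
        (fun d => c * (d.descFactorial s : ℝ) * (2 * q ^ t) ^ d) ∧
      (t = 1 ∨ t = 2 ∨ t = 3 → s = t - 1 ∧
        EqOneAddBigOMul lam (fun d => (d : ℝ) * q ^ d)
          (fun d => c * (d.descFactorial s : ℝ) * (2 * q ^ t) ^ d)) ∧
      EqOneAddBigOMul V (fun d => (d : ℝ) ^ t * q ^ (t * d)) lam) ∧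
    -- (b)
    (∀ ε : ℝ, 0 < ε →
      WithVeryHighProb p (fun d => {ω | |(Y d ω : ℝ) - lam d| < ε * √(d * lam d)}) ∧
      WithVeryHighProb p (fun d => {ω | |(Y d ω : ℝ) - lam d| < ε * lam d})) ∧
    -- (c)
    ((fun d => tvDist ((edgeMeasure p d).map (Y d)) (poissonMeasure (lam d).toNNReal))
        =O[atTop] (fun d => (d : ℝ) ^ t * q ^ (t * d)) ∧
      TendstoInDistribution (fun d ω => ((Y d ω : ℝ) - lam d) / √(V d)) atTop
        (id : ℝ → ℝ) (edgeMeasure p) (gaussianReal 0 1)) := by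
  have hq0 : 0 < q := by linarith
  have hq1 : q < 1 := by linarith
  have hq12 : 1 / 2 < q := by linarith
  have hp1' : (p : ℝ) < 1 := by linarith
  obtain rfl : Y = fun d ω => ∑ i, componentCount (H i) ω := by
    funext d ω
    exact hY d ω
  obtain ⟨⟨i₀, hi₀⟩, ht_min⟩ := ht
  obtain ⟨⟨i₁, hi₁, hi₁s⟩, hs_max⟩ := hs
  have ht_le : ∀ i, t ≤ (H i).size := fun i => ht_min ⟨i, rfl⟩
  have hs_le : ∀ i, (H i).size = t → (H i).span ≤ s := fun i hi => hs_max ⟨i, hi, rfl⟩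
  have ht1 : 1 ≤ t := hi₀ ▸ one_le_size (hconn i₀)
  have hts : t ≤ 2 ^ s := by
    have := size_le_two_pow_span (hconn i₁)
    rwa [hi₁, hi₁s] at this
  have hst : s < t := by
    have := span_lt_size (hconn i₁)
    rwa [hi₁, hi₁s] at this
  have hqt : 1 ≤ 2 * q ^ t := by
    rw [hq]
    exact one_le_two_mul_pow_of_le_maxSmallSize hp0 hp1' (hi₀ ▸ hsize i₀)
  have hbeta : ∀ i, 0 < (H i).beta p := fun i => by
    have : 0 < 1 - (p : ℝ) := by linarith
    unfold CubeSubgraph.beta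
    positivity
  have hc0 : 0 < c := by
    rw [hc]
    exact Finset.sum_pos (fun i _ => hbeta i)
      ⟨i₁, Finset.mem_filter.2 ⟨Finset.mem_univ _, hi₁, hi₁s⟩⟩
  set F : Fin r → ℕ → ℝ := fun i d =>
    (H i).beta p * d.descFactorial (H i).span * (2 * q ^ (H i).size) ^ d with hFdef
  have hlamF : lam = fun d => ∑ i, F i d := by
    funext d
    rw [hlam, integral_componentCount_eq p H hp1' hconn]
    simp only [hFdef, hq]
  have hFnn : ∀ i d, 0 ≤ F i d := fun i d => by
    have := hbeta i
    simp only [hFdef]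
    positivity
  set g : ℕ → ℝ := fun d => c * (d.descFactorial s : ℝ) * (2 * q ^ t) ^ d with hg
  have hFg : ∀ d, ∑ i with (H i).size = t ∧ (H i).span = s, F i d = g d := fun d => by
    simp only [hg, hc, Finset.sum_mul]
    refine Finset.sum_congr rfl fun i hi => ?_
    obtain ⟨-, h1, h2⟩ := Finset.mem_filter.1 hi
    simp only [hFdef, h1, h2]
  obtain ⟨c', hc', hgc'⟩ := exists_linear_lower_bound hts ht1 hq12 hqt hc0
  have hlc' : ∀ᶠ d : ℕ in atTop, c' * d ≤ lam d := by
    filter_upwards [hgc'] with d hd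
    refine hd.trans ?_
    change g d ≤ lam d
    rw [← hFg, hlamF]
    exact Finset.sum_le_sum_of_subset_of_nonneg (Finset.filter_subset _ _) fun i _ _ => hFnn i d
  have hlam_top : Tendsto lam atTop atTop :=
    tendsto_atTop_mono' _ hlc' (tendsto_natCast_atTop_atTop.const_mul_atTop hc')
  have hg0 : ∀ᶠ d in atTop, g d ≠ 0 := by
    filter_upwards [hgc', eventually_ge_atTop 1] with d hd hd1
    have : (0 : ℝ) < d := by exact_mod_cast hd1
    exact (lt_of_lt_of_le (by positivity) hd).ne'
  -- the contribution of `H i` outside the dominant class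
  have hratio : ∀ i {h : ℕ → ℝ} {j : ℕ}, (H i).size = t + j →
      (fun d : ℕ => (d : ℝ) ^ (H i).span / (d : ℝ) ^ s * (q ^ d) ^ j) =O[atTop] h →
      (fun d => F i d / g d) =O[atTop] h := fun i h j hj hh => by
    have := descFactorial_ratio_isBigO (t := t) ((H i).beta p) c hq0 hh
    rw [← hj] at this
    exact this
  have ha : EqOneAddBigOMul lam (fun d => 1 / (d : ℝ)) g := by
    rw [hlamF]
    refine eqOneAddBigOMul_sum hFg hg0 fun i hi => ?_
    obtain ⟨j, hj⟩ := Nat.exists_eq_add_of_le (ht_le i)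
    rcases Nat.eq_zero_or_pos j with rfl | hj0
    · have h1 : (H i).span < s := lt_of_le_of_ne (hs_le i hj) fun h => hi ⟨hj, h⟩
      exact hratio i hj (pow_div_pow_mul_pow_isBigO_of_lt h1 hq0 hq1)
    · exact hratio i hj (pow_div_pow_mul_pow_isBigO_of_pos _ _ hj0 hq0 hq1)
  have hsmall : t = 1 ∨ t = 2 ∨ t = 3 → ∀ i, (H i).size = t → (H i).span = t - 1 := by
    intro h3 i hi
    have h1 := span_lt_size (hconn i)
    have h2 := size_le_two_pow_span (hconn i)
    rw [hi] at h1 h2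
    -- For these sizes `span < t ≤ 2 ^ span` leaves only `span = t - 1`.
    rcases h3 with rfl | rfl | rfl <;> interval_cases (H i).span <;> simp_all
  have ha' : t = 1 ∨ t = 2 ∨ t = 3 → s = t - 1 ∧
      EqOneAddBigOMul lam (fun d => (d : ℝ) * q ^ d) g := by
    intro h3
    have hs1 : s = t - 1 := hi₁s ▸ hsmall h3 i₁ hi₁
    refine ⟨hs1, ?_⟩
    rw [hlamF]
    refine eqOneAddBigOMul_sum hFg hg0 fun i hi => ?_
    obtain ⟨j, hj⟩ := Nat.exists_eq_add_of_le (ht_le i)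
    rcases Nat.eq_zero_or_pos j with rfl | hj0
    -- All graphs of size `t` have the same span, so the `O(1/d)` terms from smaller spans are
    -- absent.
    · exact (hi ⟨hj, hs1 ▸ hsmall h3 i hj⟩).elim
    · refine hratio i hj (pow_div_pow_mul_pow_isBigO_self ?_ hj0 hq0 hq1)
      have := span_lt_size (hconn i)
      omega
  -- Poisson approximation
  set M := ∑ i, (H i).size with hM
  have hMi : ∀ i, (H i).size ≤ M := fun i =>
    Finset.single_le_sum (f := fun i => (H i).size) (fun _ _ => Nat.zero_le _) (Finset.mem_univ i)
  set K : ℝ := 1 + (1 / (p : ℝ)) ^ (M * M) with hK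
  have hpa := fun d => poisson_approximation_componentCount p H hp0 hp1 hconn hnoniso hMi d
    (hlam d)
  have hu : (fun d : ℕ => ((d : ℝ) * (1 - p) ^ d) ^ t) = fun d : ℕ => (d : ℝ) ^ t * q ^ (t * d) := by
    funext d
    rw [← hq, mul_pow, ← pow_mul, mul_comm d t]
  have hδ : (fun d => K * nearbyBound H p M d) =O[atTop]
      fun d : ℕ => (d : ℝ) ^ t * q ^ (t * d) := by
    rw [← hu]
    exact (nearbyBound_isBigO hp0 hp1' hconn ht_le M).const_mul_left K
  have hlam0 : ∀ᶠ d in atTop, 0 < lam d := hlam_top.eventually_gt_atTop 0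
  have htv : (fun d => tvDist ((edgeMeasure p d).map fun ω => ∑ i, componentCount (H i) ω)
      (poissonMeasure (lam d).toNNReal)) =O[atTop] fun d : ℕ => (d : ℝ) ^ t * q ^ (t * d) := by
    refine IsBigO.trans (IsBigO.of_bound 1 ?_) hδ
    filter_upwards [hlam0] with d hd
    rw [one_mul, Real.norm_of_nonneg (tvDist_nonneg _ _)]
    exact ((hpa d).1 hd).trans (le_abs_self _)
  have hη : (fun d => (V d - lam d) / lam d) =O[atTop]
      fun d : ℕ => (d : ℝ) ^ t * q ^ (t * d) := by
    refine IsBigO.trans (IsBigO.of_bound 1 ?_) hδ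
    filter_upwards [hlam0] with d hd
    rw [one_mul, norm_div, Real.norm_of_nonneg hd.le, Real.norm_eq_abs, hV, div_le_iff₀ hd]
    exact (hpa d).2.trans (mul_le_mul_of_nonneg_right (le_abs_self _) hd.le)
  have hVlam : EqOneAddBigOMul V (fun d => (d : ℝ) ^ t * q ^ (t * d)) lam := by
    refine ⟨_, hη, ?_⟩
    filter_upwards [hlam0] with d hd
    field_simp
    ring
  have hpow : (fun d : ℕ => (d : ℝ) ^ t * q ^ (t * d)) =O[atTop] fun d : ℕ => (d : ℝ) * q ^ d := by
    have h := isBigO_pow_of_tendsto_zero (tendsto_mul_pow_self hq0 hq1) ht1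
    rw [← hu, ← hq]
    simpa only [pow_one] using h
  have hpow0 := hpow.trans_tendsto (tendsto_mul_pow_self hq0 hq1)
  have hb : ∀ ε : ℝ, 0 < ε → WithVeryHighProb p fun d =>
      {ω | |((∑ i, componentCount (H i) ω : ℕ) : ℝ) - lam d| < ε * √(d * lam d)} := fun ε hε =>
    withVeryHighProb_abs_sub_lt_of_tvDist hq0 hq1 hc' hlc' (htv.trans hpow) hε
  refine ⟨⟨hc0, ha, ha', hVlam⟩, fun ε hε => ⟨hb ε hε, ?_⟩, htv, ?_⟩
  -- Since `c' d ≤ λ`, one has `√c' √(dλ) ≤ λ`.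
  · refine (hb (ε * √c') (by positivity)).mono ?_
    filter_upwards [hlc', hlam0] with d hd hd0 ω hω
    rw [Set.mem_ofPred_eq] at hω ⊢
    refine hω.trans_le ?_
    rw [mul_assoc, ← Real.sqrt_mul hc'.le]
    refine mul_le_mul_of_nonneg_left ?_ hε.le
    calc √(c' * (d * lam d)) ≤ √(lam d * lam d) := by
          rw [← mul_assoc]
          gcongr
      _ = lam d := Real.sqrt_mul_self hd0.le
  · refine tendstoInDistribution_of_tvDist_poisson (fun d => Measurable.of_discrete) hlam_top ?_
      (htv.trans_tendsto hpow0)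
    have h1 : Tendsto (fun d => 1 + (V d - lam d) / lam d) atTop (𝓝 1) := by
      simpa using (hη.trans_tendsto hpow0).const_add 1
    refine h1.congr' ?_
    filter_upwards [hlam0] with d hd
    field_simp
    ring
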